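/- Let $T>0$, let $A:\mathbb{R}\to\mathbb{R}^{n\times n}$, $B:\mathbb{R}\to\mathbb{R}^{n\times m}$, $C:\mathbb{R}\to\mathbb{R}^{r\times n}$ and $R:\mathbb{R}\to\mathbb{R}^{m\times m}$ be continuous and $T$-periodic, and let $R(t)$ be symmetric positive definite for every $t$. Consider the periodic Riccati equation $$-\dot P(t)=A^T(t)P(t)+P(t)A(t)-P(t)B(t)R^{-1}(t)B^T(t)P(t)+C^T(t)C(t).\qquad(\mathrm{PRE})$$ Call a continuous $T$-periodic $D:\mathbb{R}\to\mathbb{R}^{n\times n}$ asymptotically stable if all its characteristic multipliers, i.e. the eigenvalues of $\Phi_D(T,0)$, where $\Phi_D$ is the state transition matrix of $\dot x=D(t)x$, lie in the open unit disk. Assume that $(A,B)$ is stabilizable and $(A,C)$ is detectable: there are continuous $T$-periodic $K:\mathbb{R}\to\mathbb{R}^{m\times n}$ and $L:\mathbb{R}\to\mathbb{R}^{n\times r}$ such that $A-BK$ and $A-LC$ are asymptotically stable. Then (PRE) has exactly one symmetric, $T$-periodic, positive semidefinite solution $P^*$ on $\mathbb{R}$, and it is stabilizing, i.e. $A-BR^{-1}B^TP^*$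 is asymptotically stable. Moreover, for every $t_f\in\mathbb{R}$ and every symmetric positive semidefinite $G\in\mathbb{R}^{n\times n}$, (PRE) has exactly one solution $P(\cdot\,;t_f,G)$ on $(-\infty,t_f]$ with $P(t_f;t_f,G)=G$, and $$\lim_{t\to-\infty}\bigl(P(t;t_f,G)-P^*(t)\bigr)=0.$$ -/

import Mathlib

open Matrix

/-- `Φ t s` is the state transition matrix of `x'(t) = A(t) x(t)`:
`∂Φ(t,s)/∂t = A(t) Φ(t,s)` and `Φ(s,s) = I`. -/
def IsTransitionMatrix {n : ℕ} (A : ℝ → Matrix (Fin n) (Fin n) ℝ)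
    (Φ : ℝ → ℝ → Matrix (Fin n) (Fin n) ℝ) : Prop :=
  (∀ s, Φ s s = 1) ∧ ∀ t s, HasDerivAt (fun τ => Φ τ s) (A t * Φ t s) t

/-- Asymptotic stability of the `T`-periodic system `x' = A(t) x`: all its characteristic
multipliers, i.e. the complex eigenvalues of the monodromy matrix `Φ(t₀ + T, t₀)`, lie in the open
unit disk. For `T`-periodic `A` these eigenvalues do not depend on `t₀`; we take `t₀ = 0`. -/
def IsAsympStable {n : ℕ} (T : ℝ) (A : ℝ → Matrix (Fin n) (Fin n) ℝ) : Prop :=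
  ∃ Φ, IsTransitionMatrix A Φ ∧
    ∀ μ ∈ spectrum ℂ ((Φ T 0).map (algebraMap ℝ ℂ)), ‖μ‖ < 1

/-- `(A, B)` is stabilizable: some continuous `T`-periodic state feedback `u = -K(t) x` makes the
closed loop asymptotically stable. -/
def IsStabilizable {n m : ℕ} (T : ℝ) (A : ℝ → Matrix (Fin n) (Fin n) ℝ)
    (B : ℝ → Matrix (Fin n) (Fin m) ℝ) : Prop :=
  ∃ K : ℝ → Matrix (Fin m) (Fin n) ℝ, Continuous K ∧ Function.Periodic K T ∧
    IsAsympStable T (fun t => A t - B t * K t)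

/-- `(A, C)` is detectable: some continuous `T`-periodic output injection `L(t)` makes
`A - L C` asymptotically stable. -/
def IsDetectable {n r : ℕ} (T : ℝ) (A : ℝ → Matrix (Fin n) (Fin n) ℝ)
    (C : ℝ → Matrix (Fin r) (Fin n) ℝ) : Prop :=
  ∃ L : ℝ → Matrix (Fin n) (Fin r) ℝ, Continuous L ∧ Function.Periodic L T ∧
    IsAsympStable T (fun t => A t - L t * C t)

/-- The right-hand side `AᵀP + PA - P B R⁻¹ Bᵀ P + CᵀC` of the Riccati equation
`-P' = AᵀP + PA - P B R⁻¹ Bᵀ P + CᵀC`, at time `t`. -/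
noncomputable def riccatiRHS {n m r : ℕ} (A : ℝ → Matrix (Fin n) (Fin n) ℝ)
    (B : ℝ → Matrix (Fin n) (Fin m) ℝ) (C : ℝ → Matrix (Fin r) (Fin n) ℝ)
    (R : ℝ → Matrix (Fin m) (Fin m) ℝ) (t : ℝ) (P : Matrix (Fin n) (Fin n) ℝ) :
    Matrix (Fin n) (Fin n) ℝ :=
  (A t)ᵀ * P + P * A t - P * B t * (R t)⁻¹ * (B t)ᵀ * P + (C t)ᵀ * C t

/-- `P` is a symmetric, `T`-periodic, positive semidefinite solution of the periodic Riccati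
equation on the whole real line (`Matrix.PosSemidef` includes symmetry). -/
def IsSPPSSolution {n m r : ℕ} (T : ℝ) (A : ℝ → Matrix (Fin n) (Fin n) ℝ)
    (B : ℝ → Matrix (Fin n) (Fin m) ℝ) (C : ℝ → Matrix (Fin r) (Fin n) ℝ)
    (R : ℝ → Matrix (Fin m) (Fin m) ℝ) (P : ℝ → Matrix (Fin n) (Fin n) ℝ) : Prop :=
  (∀ t, HasDerivAt P (-riccatiRHS A B C R t (P t)) t) ∧
    Function.Periodic P T ∧ ∀ t, (P t).PosSemidef

/-- The SPPS solution `P` is stabilizing: `A - B R⁻¹ Bᵀ P` has all its characteristic multipliers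
in the open unit disk. -/
def IsStabilizingSolution {n m r : ℕ} (T : ℝ) (A : ℝ → Matrix (Fin n) (Fin n) ℝ)
    (B : ℝ → Matrix (Fin n) (Fin m) ℝ) (C : ℝ → Matrix (Fin r) (Fin n) ℝ)
    (R : ℝ → Matrix (Fin m) (Fin m) ℝ) (P : ℝ → Matrix (Fin n) (Fin n) ℝ) : Prop :=
  IsSPPSSolution T A B C R P ∧
    IsAsympStable T (fun t => A t - B t * (R t)⁻¹ * (B t)ᵀ * P t)

/-- `P` solves the Riccati equation on `(-∞, t_f]` (one-sided derivative at `t_f`) with final value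
`P(t_f) = G`; the values of `P` after `t_f` are irrelevant. -/
def IsFinalValueSolution {n m r : ℕ} (A : ℝ → Matrix (Fin n) (Fin n) ℝ)
    (B : ℝ → Matrix (Fin n) (Fin m) ℝ) (C : ℝ → Matrix (Fin r) (Fin n) ℝ)
    (R : ℝ → Matrix (Fin m) (Fin m) ℝ) (t_f : ℝ) (G : Matrix (Fin n) (Fin n) ℝ)
    (P : ℝ → Matrix (Fin n) (Fin n) ℝ) : Prop :=
  (∀ t ∈ Set.Iic t_f, HasDerivWithinAt P (-riccatiRHS A B C R t (P t)) (Set.Iic t_f) t) ∧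
    P t_f = G

/-!
With `S = B R⁻¹ Bᵀ` and `Q = CᵀC` the Riccati equation reads `-P' = AᵀP + PA - PSP + Q`, and
`P = Y X⁻¹` turns it into the linear Hamiltonian system `X' = AX - SY`, `Y' = -QX - AᵀY`.  That
system has global solutions, and when `X = 1` and `Y = G ≥ 0` at the final time, `XᵀY` is
nonincreasing; this keeps `XᵀY ≥ 0` and `X` invertible backwards in time
(`IsHamiltonianSol.isUnit_left`), so the final value problem has a positive semidefinite solution on
the whole half-line.  Moreover `X' = (A - SP) X`, so `X` is the fundamental matrix of the closed
loop of `P`.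

The difference `D` of two solutions satisfies `(XᵀDX)' = XᵀDSDX ≥ 0` along the closed loop of the
second one.  This single identity (`IsRiccatiSolOn.posSemidef_conj_sub`) gives monotonicity in the
final value as well as the upper bound in the convergence proof.

By monotonicity the values at `-kT` of the solution vanishing at time `0` increase in `k`.
Stabilizability bounds them, through the cost of the stabilizing feedback
(`exists_flow_period_le`, `exists_flow_zero_bound`), so they converge to a fixed point of the period
map (`exists_fixedPoint`).  The Hamiltonian solution through it satisfies
`X (t - T) = X t * X (-T)`, which makes `X` invertible on `ℝ` and `P* = Y X⁻¹` a periodic solution.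

Detectability makes `P*` stabilizing: the energy `vᵀXᵀP*Xv` cannot increase, and if an eigenvector
of the closed-loop monodromy matrix has a multiplier of modulus at least `1`, its energy is
constant over a period, so the observed output and the feedback vanish along its trajectory.  The
multiplier then belongs to the stable system `A - LC` (`norm_lt_one_of_mem_spectrum`).

Finally, the values at `-kT` of any positive semidefinite solution are squeezed between those of
the solution vanishing at `0` and a bound that decays along the stable closed loop of `P*`
(`tendsto_flow_nat`); compactness of a period extends the convergence to continuous time, uniformly
over the phase (`tendsto_flow`).  A second periodic solution differs from `P*` by a periodic
function that tends to zero, hence equals it.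
-/

/-! ### Linear differential equations in Banach spaces and algebras -/

section LinearODE

variable {𝔸 : Type*} [NormedRing 𝔸] [NormedAlgebra ℝ 𝔸]

/-- The terms of the Dyson (Peano–Baker) series of `W' = H W`, `W t₀ = 1`. -/
noncomputable def dysonTerm (H : ℝ → 𝔸) (t₀ : ℝ) : ℕ → ℝ → 𝔸
  | 0 => fun _ => 1
  | k + 1 => fun t => ∫ s in t₀..t, H s * dysonTerm H t₀ k s

theorem continuous_dysonTerm [CompleteSpace 𝔸] {H : ℝ → 𝔸} (hH : Continuous H) (t₀ : ℝ) (k : ℕ) :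
    Continuous (dysonTerm H t₀ k) := by
  induction k with
  | zero => exact continuous_const
  | succ k ih =>
    exact intervalIntegral.continuous_primitive
      (fun a b => (hH.mul ih).intervalIntegrable a b) t₀

theorem hasDerivAt_dysonTerm_succ [CompleteSpace 𝔸] {H : ℝ → 𝔸} (hH : Continuous H) (t₀ : ℝ)
    (k : ℕ) (t : ℝ) :
    HasDerivAt (dysonTerm H t₀ (k + 1)) (H t * dysonTerm H t₀ k t) t :=
  ((hH.mul (continuous_dysonTerm hH t₀ k)).integral_hasStrictDerivAt t₀ t).hasDerivAt

theorem norm_dysonTerm_le {H : ℝ → 𝔸} {t₀ r K : ℝ} (hH : Continuous H) [CompleteSpace 𝔸]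
    (hK : ∀ t ∈ Metric.ball t₀ r, ‖H t‖ ≤ K) (k : ℕ) :
    ∀ t ∈ Metric.ball t₀ r,
      ‖dysonTerm H t₀ k t‖ ≤ ‖(1 : 𝔸)‖ * (K ^ k * |t - t₀| ^ k / k.factorial) := by
  induction k with
  | zero => intro t _; simp [dysonTerm]
  | succ k ih =>
    intro t ht
    have hK0 : 0 ≤ K := (norm_nonneg _).trans (hK t ht)
    have hsub : Set.uIoc t₀ t ⊆ Metric.ball t₀ r := by
      have h0 : t₀ ∈ Metric.ball t₀ r := Metric.mem_ball_self (dist_nonneg.trans_lt ht)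
      exact Set.uIoc_subset_uIcc.trans
        ((convex_ball t₀ r).ordConnected.uIcc_subset h0 ht)
    calc ‖dysonTerm H t₀ (k + 1) t‖
        ≤ ∫ s in Set.uIoc t₀ t, ‖H s * dysonTerm H t₀ k s‖ :=
          intervalIntegral.norm_integral_le_integral_norm_uIoc
      _ ≤ ∫ s in Set.uIoc t₀ t,
            ‖(1 : 𝔸)‖ * (K ^ (k + 1) / k.factorial) * |s - t₀| ^ k := by
          refine MeasureTheory.setIntegral_mono_on ?_ ?_ measurableSet_uIoc ?_
          · exact ((hH.mul (continuous_dysonTerm hH t₀ k)).norm.intervalIntegrable t₀ t).def'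
          · exact (Continuous.intervalIntegrable (by fun_prop) t₀ t).def'
          · intro s hs
            calc ‖H s * dysonTerm H t₀ k s‖ ≤ ‖H s‖ * ‖dysonTerm H t₀ k s‖ := norm_mul_le _ _
              _ ≤ K * (‖(1 : 𝔸)‖ * (K ^ k * |s - t₀| ^ k / k.factorial)) :=
                mul_le_mul (hK s (hsub hs)) (ih s (hsub hs)) (norm_nonneg _) hK0
              _ = _ := by ring
      _ = ‖(1 : 𝔸)‖ * (K ^ (k + 1) * |t - t₀| ^ (k + 1) / (k + 1).factorial) := by
          rw [MeasureTheory.integral_const_mul, integral_pow_abs_sub_uIoc, Nat.factorial_succ]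
          push_cast
          field_simp

/-- Global existence of the fundamental solution of a linear differential equation in a Banach
algebra, as the sum of the Dyson series. -/
theorem exists_fundamental_solution [CompleteSpace 𝔸] {H : ℝ → 𝔸} (hH : Continuous H) (t₀ : ℝ) :
    ∃ W : ℝ → 𝔸, W t₀ = 1 ∧ ∀ t, HasDerivAt W (H t * W t) t := by
  have hzero : ∀ k, dysonTerm H t₀ (k + 1) t₀ = 0 := fun k => by simp [dysonTerm]
  have key : ∀ t, Summable (fun k => dysonTerm H t₀ k t) ∧
      HasDerivAt (fun t => ∑' k, dysonTerm H t₀ (k + 1) t) (∑' k, H t * dysonTerm H t₀ k t) t := by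
    intro t
    obtain ⟨r, hr0, htr⟩ : ∃ r : ℝ, 0 < r ∧ t ∈ Metric.ball t₀ r :=
      ⟨dist t t₀ + 1, by positivity, by simp⟩
    obtain ⟨K, hK⟩ := (isCompact_closedBall t₀ r).exists_bound_of_continuousOn hH.continuousOn
    have hK' : ∀ s ∈ Metric.ball t₀ r, ‖H s‖ ≤ K :=
      fun s hs => hK s (Metric.ball_subset_closedBall hs)
    have hK0 : 0 ≤ K := (norm_nonneg _).trans (hK' t htr)
    have hb : ∀ k, ∀ s ∈ Metric.ball t₀ r,
        ‖dysonTerm H t₀ k s‖ ≤ ‖(1 : 𝔸)‖ * ((K * r) ^ k / k.factorial) := by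
      intro k s hs
      refine (norm_dysonTerm_le hH hK' k s hs).trans ?_
      rw [mul_pow]
      have : |s - t₀| ≤ r := (Metric.mem_ball.1 hs).le
      gcongr
    have hsum : Summable fun k : ℕ => ‖(1 : 𝔸)‖ * ((K * r) ^ k / k.factorial) :=
      (Real.summable_pow_div_factorial (K * r)).mul_left _
    refine ⟨.of_norm_bounded hsum fun k => hb k t htr, ?_⟩
    refine hasDerivAt_tsum_of_isPreconnected (hsum.mul_left K) Metric.isOpen_ball
      (convex_ball t₀ r).isPreconnected (fun k s _ => hasDerivAt_dysonTerm_succ hH t₀ k s)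
      (fun k s hs => ?_) (Metric.mem_ball_self hr0) ?_ htr
    · exact (norm_mul_le _ _).trans
        (mul_le_mul (hK' s hs) (hb k s hs) (norm_nonneg _) hK0)
    · simp only [hzero]
      exact summable_zero
  -- The constant term is split off, so that every summand left vanishes at `t₀`.
  refine ⟨fun t => 1 + ∑' k, dysonTerm H t₀ (k + 1) t, by simp [hzero], fun t => ?_⟩
  have h := ((key t).2).const_add 1
  have hs := (key t).1
  rw [hs.tsum_mul_left, hs.tsum_eq_zero_add] at h
  exact h

variable {E : Type*} [NormedAddCommGroup E] [NormedSpace ℝ E]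

/-- Grönwall uniqueness from the left or the right end of a compact interval. -/
theorem eq_zero_of_norm_deriv_le {f f' : ℝ → E} {K a b c : ℝ}
    (hf : ∀ t ∈ Set.Icc a b, HasDerivWithinAt f (f' t) (Set.Icc a b) t)
    (hK : ∀ t ∈ Set.Icc a b, ‖f' t‖ ≤ K * ‖f t‖) (hc : c = a ∨ c = b) (h0 : f c = 0) :
    ∀ t ∈ Set.Icc a b, f t = 0 := by
  have fwd : ∀ {f f' : ℝ → E} {a b : ℝ},
      (∀ t ∈ Set.Icc a b, HasDerivWithinAt f (f' t) (Set.Icc a b) t) →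
      (∀ t ∈ Set.Icc a b, ‖f' t‖ ≤ K * ‖f t‖) → f a = 0 → ∀ t ∈ Set.Icc a b, f t = 0 := by
    intro f f' a b hf hK h0
    refine eq_zero_of_abs_deriv_le_mul_abs_self_of_eq_zero_right (K := K) (f' := f')
      (fun t ht => (hf t ht).continuousWithinAt) (fun t ht => ?_) h0
      fun t ht => hK t (Set.Ico_subset_Icc_self ht)
    exact (hf t (Set.Ico_subset_Icc_self ht)).mono_of_mem_nhdsWithin
      (Icc_mem_nhdsGE_of_mem ht)
  rcases hc with rfl | rfl
  · exact fwd hf hK h0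
  · intro t ht
    have hmaps : Set.MapsTo (fun s : ℝ => -s) (Set.Icc (-c) (-a)) (Set.Icc a c) :=
      fun s hs => ⟨by linarith [hs.2], by linarith [hs.1]⟩
    have := fwd (f := fun s => f (-s)) (f' := fun s => -f' (-s)) (a := -c) (b := -a)
      (fun s hs => by
        have h := (hf (-s) (hmaps hs)).scomp s ((hasDerivAt_neg s).hasDerivWithinAt) hmaps
        simpa [Function.comp_def] using h)
      (fun s hs => by simpa using hK (-s) (hmaps hs)) (by simpa using h0) (-t)
      ⟨by linarith [ht.2], by linarith [ht.1]⟩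
    simpa using this

end LinearODE

/-! ### Matrix functions and the Loewner order -/

section MatrixCalculus

open scoped Matrix.Norms.Operator

variable {m n : Type*} [Fintype n]

/-- Differentiability of matrix functions is entrywise. -/
theorem hasDerivWithinAt_matrix {P : ℝ → Matrix m n ℝ} {P' : Matrix m n ℝ} {s : Set ℝ} {t : ℝ} :
    HasDerivWithinAt P P' s t ↔
      ∀ i j, HasDerivWithinAt (fun τ => P τ i j) (P' i j) s t := by
  have h := @hasDerivWithinAt_pi ℝ _ t s m (fun _ => n → ℝ) _ _ P P'
  simp only [hasDerivWithinAt_pi] at h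
  exact h

theorem hasDerivAt_matrix {P : ℝ → Matrix m n ℝ} {P' : Matrix m n ℝ} {t : ℝ} :
    HasDerivAt P P' t ↔ ∀ i j, HasDerivAt (fun τ => P τ i j) (P' i j) t := by
  have h := @hasDerivAt_pi ℝ _ t m (fun _ => n → ℝ) _ _ P P'
  simp only [hasDerivAt_pi] at h
  exact h

theorem HasDerivWithinAt.mulVec_const {P : ℝ → Matrix m n ℝ} {P' : Matrix m n ℝ} {s : Set ℝ}
    {t : ℝ} (h : HasDerivWithinAt P P' s t) (v : n → ℝ) :
    HasDerivWithinAt (fun τ => P τ *ᵥ v) (P' *ᵥ v) s t := by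
  refine hasDerivWithinAt_pi.2 fun i => ?_
  simp only [mulVec, dotProduct]
  exact HasDerivWithinAt.fun_sum fun j _ => (hasDerivWithinAt_matrix.1 h i j).mul_const (v j)

variable [Fintype m]

theorem HasDerivWithinAt.matrix_transpose {P : ℝ → Matrix m n ℝ} {P' : Matrix m n ℝ} {s : Set ℝ}
    {t : ℝ} (h : HasDerivWithinAt P P' s t) : HasDerivWithinAt (fun τ => (P τ)ᵀ) P'ᵀ s t :=
  hasDerivWithinAt_matrix.2 fun i j => hasDerivWithinAt_matrix.1 h j i

theorem HasDerivAt.matrix_transpose {P : ℝ → Matrix m n ℝ} {P' : Matrix m n ℝ}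
    {t : ℝ} (h : HasDerivAt P P' t) : HasDerivAt (fun τ => (P τ)ᵀ) P'ᵀ t :=
  hasDerivAt_matrix.2 fun i j => hasDerivAt_matrix.1 h j i

theorem HasDerivWithinAt.quadForm {P : ℝ → Matrix n n ℝ} {P' : Matrix n n ℝ} {s : Set ℝ}
    {t : ℝ} (h : HasDerivWithinAt P P' s t) (v : n → ℝ) :
    HasDerivWithinAt (fun τ => v ⬝ᵥ P τ *ᵥ v) (v ⬝ᵥ P' *ᵥ v) s t := by
  simp only [dotProduct]
  exact HasDerivWithinAt.fun_sum fun i _ =>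
    (hasDerivWithinAt_pi.1 (h.mulVec_const v) i).const_mul (v i)

theorem posSemidef_iff_real {M : Matrix n n ℝ} :
    M.PosSemidef ↔ Mᵀ = M ∧ ∀ v : n → ℝ, 0 ≤ v ⬝ᵥ M *ᵥ v := by
  simp [posSemidef_iff_dotProduct_mulVec, IsHermitian, conjTranspose_eq_transpose_of_trivial]

theorem Matrix.PosSemidef.transpose_eq {M : Matrix n n ℝ} (h : M.PosSemidef) : Mᵀ = M :=
  (posSemidef_iff_real.1 h).1

theorem Matrix.PosSemidef.quadForm_nonneg {M : Matrix n n ℝ} (h : M.PosSemidef) (v : n → ℝ) :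
    0 ≤ v ⬝ᵥ M *ᵥ v :=
  (posSemidef_iff_real.1 h).2 v

theorem Matrix.PosSemidef.transpose_mul_mul {M : Matrix n n ℝ} (h : M.PosSemidef)
    (N : Matrix n m ℝ) : (Nᵀ * M * N).PosSemidef := by
  simpa [conjTranspose_eq_transpose_of_trivial] using h.conjTranspose_mul_mul_same N

theorem quadForm_transpose_mul_mul (M : Matrix n n ℝ) (N : Matrix n m ℝ) (v : m → ℝ) :
    v ⬝ᵥ (Nᵀ * M * N) *ᵥ v = (N *ᵥ v) ⬝ᵥ M *ᵥ (N *ᵥ v) := by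
  rw [← mulVec_mulVec, ← mulVec_mulVec, dotProduct_mulVec, vecMul_transpose]

/-- A matrix function with positive semidefinite derivative is nondecreasing in the Loewner
order. -/
theorem posSemidef_sub_of_deriv {E E' : ℝ → Matrix n n ℝ} {a b : ℝ} (hab : a ≤ b)
    (hE : ∀ t ∈ Set.Icc a b, HasDerivWithinAt E (E' t) (Set.Icc a b) t)
    (hpos : ∀ t ∈ Set.Icc a b, (E' t).PosSemidef) : (E b - E a).PosSemidef := by
  refine posSemidef_iff_real.2 ⟨?_, fun v => ?_⟩
  -- The antisymmetric part of `E` has derivative zero, so `E b - E a` is symmetric although `E`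
  -- need not be.
  · have h := eq_zero_of_norm_deriv_le (K := 0) (c := a) (a := a) (b := b)
      (f := fun t i j => ((E t)ᵀ - E t - ((E a)ᵀ - E a)) i j) (f' := fun _ => 0) (fun t ht => by
        have h := (((hE t ht).matrix_transpose.sub (hE t ht)).sub_const ((E a)ᵀ - E a))
        rw [(hpos t ht).transpose_eq, sub_self] at h
        exact h) (by simp) (.inl rfl) (by ext; simp) b ⟨hab, le_rfl⟩
    ext i j
    have := congrFun (congrFun h i) j
    simp at this ⊢
    linarith
  · rw [sub_mulVec, dotProduct_sub, sub_nonneg]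
    refine monotoneOn_of_deriv_nonneg (convex_Icc a b) (f := fun t => v ⬝ᵥ E t *ᵥ v)
      (fun t ht => ((hE t ht).quadForm v).continuousWithinAt)
      (fun t ht => ?_) (fun t ht => ?_) ⟨le_rfl, hab⟩ ⟨hab, le_rfl⟩ hab
    · exact ((hE t (interior_subset ht)).quadForm v).differentiableWithinAt.mono interior_subset
    · rw [(((hE t (interior_subset ht)).quadForm v).hasDerivAt
        (mem_interior_iff_mem_nhds.1 ht)).deriv]
      exact (hpos t (interior_subset ht)).quadForm_nonneg v

/-- If a Loewner-nondecreasing quadratic form takes the same value at both ends, its derivative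
vanishes in between. -/
theorem quadForm_deriv_eq_zero {E E' : ℝ → Matrix n n ℝ} {a b : ℝ} (hab : a < b)
    (hE : ∀ t ∈ Set.Icc a b, HasDerivWithinAt E (E' t) (Set.Icc a b) t)
    (hpos : ∀ t ∈ Set.Icc a b, (E' t).PosSemidef) {v : n → ℝ}
    (hv : v ⬝ᵥ E b *ᵥ v ≤ v ⬝ᵥ E a *ᵥ v) :
    ∀ t ∈ Set.Icc a b, v ⬝ᵥ E' t *ᵥ v = 0 := by
  have mono : ∀ s ∈ Set.Icc a b, ∀ t ∈ Set.Icc a b, s ≤ t →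
      v ⬝ᵥ E s *ᵥ v ≤ v ⬝ᵥ E t *ᵥ v := by
    intro s hs t ht hst
    have hsub := Set.Icc_subset_Icc hs.1 ht.2
    have h := (posSemidef_sub_of_deriv hst (fun τ hτ => (hE τ (hsub hτ)).mono hsub)
      (fun τ hτ => hpos τ (hsub hτ))).quadForm_nonneg v
    rwa [sub_mulVec, dotProduct_sub, sub_nonneg] at h
  intro t ht
  have hconst : ∀ s ∈ Set.Icc a b, v ⬝ᵥ E s *ᵥ v = v ⬝ᵥ E a *ᵥ v := fun s hs =>
    le_antisymm ((mono s hs b ⟨hab.le, le_rfl⟩ hs.2).trans hv) (mono a ⟨le_rfl, hab.le⟩ s hs hs.1)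
  have h1 := ((hE t ht).quadForm v)
  have h2 := (hasDerivWithinAt_const t (Set.Icc a b) (v ⬝ᵥ E a *ᵥ v)).congr hconst (hconst t ht)
  exact (uniqueDiffOn_Icc hab t ht).eq_deriv _ h1 h2

end MatrixCalculus

/-! ### The Riccati equation: uniqueness and comparison -/

section Riccati

open scoped Matrix.Norms.Operator

variable {n : Type*} [Fintype n] {A S Q : ℝ → Matrix n n ℝ}

/-- The right-hand side `AᵀP + PA - PSP + Q` of the Riccati equation, where `S` stands for
`B R⁻¹ Bᵀ` and `Q` for `CᵀC`. -/
def riccatiField (A S Q : ℝ → Matrix n n ℝ) (t : ℝ) (P : Matrix n n ℝ) : Matrix n n ℝ :=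
  (A t)ᵀ * P + P * A t - P * S t * P + Q t

/-- `P` solves the Riccati equation `-P' = AᵀP + PA - PSP + Q` on the set `s`, with derivatives
taken within `s`. -/
def IsRiccatiSolOn (A S Q : ℝ → Matrix n n ℝ) (s : Set ℝ) (P : ℝ → Matrix n n ℝ) : Prop :=
  ∀ t ∈ s, HasDerivWithinAt P (-riccatiField A S Q t (P t)) s t

theorem IsRiccatiSolOn.mono {s s' : Set ℝ} {P : ℝ → Matrix n n ℝ}
    (h : IsRiccatiSolOn A S Q s P) (hs : s' ⊆ s) : IsRiccatiSolOn A S Q s' P :=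
  fun t ht => (h t (hs ht)).mono hs

theorem IsRiccatiSolOn.continuousOn {s : Set ℝ} {P : ℝ → Matrix n n ℝ}
    (h : IsRiccatiSolOn A S Q s P) : ContinuousOn P s :=
  fun t ht => (h t ht).continuousWithinAt

theorem IsRiccatiSolOn.of_hasDerivAt {s : Set ℝ} {P : ℝ → Matrix n n ℝ}
    (h : ∀ t, HasDerivAt P (-riccatiField A S Q t (P t)) t) : IsRiccatiSolOn A S Q s P :=
  fun t _ => (h t).hasDerivWithinAt

theorem IsRiccatiSolOn.sub_const {P : ℝ → Matrix n n ℝ} {b c : ℝ}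
    (h : IsRiccatiSolOn A S Q (Set.Iic b) P) (hA : Function.Periodic A c)
    (hS : Function.Periodic S c) (hQ : Function.Periodic Q c) :
    IsRiccatiSolOn A S Q (Set.Iic (b + c)) fun t => P (t - c) := by
  intro t ht
  have hm : Set.MapsTo (fun s : ℝ => s - c) (Set.Iic (b + c)) (Set.Iic b) :=
    fun s hs => by simpa using hs
  have h1 := (h (t - c) (hm ht)).scomp t ((hasDerivAt_id t).sub_const c).hasDerivWithinAt hm
  have hA' := hA (t - c)
  have hS' := hS (t - c)
  have hQ' := hQ (t - c)
  rw [sub_add_cancel] at hA' hS' hQ'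
  refine h1.congr_deriv ?_
  simp [riccatiField, hA', hS', hQ']

variable [DecidableEq n]

/-- Solutions of the Riccati equation with the same final value agree: their difference solves a
linear differential equation. -/
theorem IsRiccatiSolOn.eqOn {P₁ P₂ : ℝ → Matrix n n ℝ} {b : ℝ} (hA : Continuous A)
    (hS : Continuous S) (h₁ : IsRiccatiSolOn A S Q (Set.Iic b) P₁)
    (h₂ : IsRiccatiSolOn A S Q (Set.Iic b) P₂) (hb : P₁ b = P₂ b) :
    Set.EqOn P₁ P₂ (Set.Iic b) := by
  intro a ha
  have h₁' := h₁.mono (Set.Icc_subset_Iic_self (a := a))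
  have h₂' := h₂.mono (Set.Icc_subset_Iic_self (a := a))
  have hc₁ := h₁'.continuousOn
  have hc₂ := h₂'.continuousOn
  obtain ⟨K, hK⟩ := (isCompact_Icc (a := a) (b := b)).exists_bound_of_continuousOn
    (f := fun t => ‖(A t)ᵀ‖ + ‖A t‖ + ‖P₁ t * S t‖ + ‖S t * P₂ t‖) (by
      have hA' : Continuous fun t => (A t)ᵀ := hA.matrix_transpose
      exact ((hA'.norm.add hA.norm).continuousOn.add (hc₁.mul hS.continuousOn).norm).add
        (hS.continuousOn.mul hc₂).norm)
  have key := eq_zero_of_norm_deriv_le (f := fun t => P₁ t - P₂ t) (K := K) (c := b)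
    (f' := fun t => -((A t)ᵀ * (P₁ t - P₂ t) + (P₁ t - P₂ t) * A t - P₁ t * S t * (P₁ t - P₂ t)
      - (P₁ t - P₂ t) * (S t * P₂ t)))
    (fun t ht => by
      refine ((h₁' t ht).sub (h₂' t ht)).congr_deriv ?_
      simp only [riccatiField]
      noncomm_ring)
    (fun t ht => by
      have hKt := (le_abs_self _).trans (hK t ht)
      set D := P₁ t - P₂ t
      calc _ = ‖(A t)ᵀ * D + D * A t - P₁ t * S t * D - D * (S t * P₂ t)‖ := norm_neg _
        _ ≤ ‖(A t)ᵀ * D‖ + ‖D * A t‖ + ‖P₁ t * S t * D‖ + ‖D * (S t * P₂ t)‖ :=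
          (norm_sub_le _ _).trans (add_le_add_left ((norm_sub_le _ _).trans
            (add_le_add_left (norm_add_le _ _) _)) _)
        _ ≤ ‖(A t)ᵀ‖ * ‖D‖ + ‖D‖ * ‖A t‖ + ‖P₁ t * S t‖ * ‖D‖ + ‖D‖ * ‖S t * P₂ t‖ := by
          gcongr <;> exact norm_mul_le _ _
        _ = (‖(A t)ᵀ‖ + ‖A t‖ + ‖P₁ t * S t‖ + ‖S t * P₂ t‖) * ‖D‖ := by ring
        _ ≤ K * ‖D‖ := by gcongr)
    (.inr rfl) (sub_eq_zero.2 hb) a ⟨le_rfl, ha⟩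
  exact sub_eq_zero.1 key

/-- Along the closed loop `X' = (A - S P₂) X` of the second solution, the difference `D` of two
symmetric solutions satisfies `(XᵀDX)' = XᵀDSDX`. -/
theorem IsRiccatiSolOn.hasDerivWithinAt_conj {P₁ P₂ X : ℝ → Matrix n n ℝ} {s : Set ℝ} {t : ℝ}
    (ht : t ∈ s) (h₁ : IsRiccatiSolOn A S Q s P₁) (h₂ : IsRiccatiSolOn A S Q s P₂)
    (hS : (S t)ᵀ = S t) (hP₂ : (P₂ t)ᵀ = P₂ t)
    (hX : HasDerivWithinAt X ((A t - S t * P₂ t) * X t) s t) :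
    HasDerivWithinAt (fun τ => (X τ)ᵀ * (P₁ τ - P₂ τ) * X τ)
      ((X t)ᵀ * ((P₁ t - P₂ t) * S t * (P₁ t - P₂ t)) * X t) s t := by
  refine ((hX.matrix_transpose.mul ((h₁ t ht).sub (h₂ t ht))).mul hX).congr_deriv ?_
  simp only [riccatiField, transpose_mul, transpose_sub, hS, hP₂, Pi.mul_apply, Pi.sub_apply]
  noncomm_ring

/-- Comparison of two symmetric solutions along the closed loop of the second one. -/
theorem IsRiccatiSolOn.posSemidef_conj_sub {P₁ P₂ X : ℝ → Matrix n n ℝ} {a b : ℝ} (hab : a ≤ b)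
    (h₁ : IsRiccatiSolOn A S Q (Set.Icc a b) P₁) (h₂ : IsRiccatiSolOn A S Q (Set.Icc a b) P₂)
    (hS : ∀ t, (S t).PosSemidef) (hP₁ : ∀ t ∈ Set.Icc a b, (P₁ t)ᵀ = P₁ t)
    (hP₂ : ∀ t ∈ Set.Icc a b, (P₂ t)ᵀ = P₂ t)
    (hX : ∀ t ∈ Set.Icc a b,
      HasDerivWithinAt X ((A t - S t * P₂ t) * X t) (Set.Icc a b) t) :
    ((X b)ᵀ * (P₁ b - P₂ b) * X b - (X a)ᵀ * (P₁ a - P₂ a) * X a).PosSemidef := by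
  refine posSemidef_sub_of_deriv hab (fun t ht =>
    h₁.hasDerivWithinAt_conj ht h₂ (hS t).transpose_eq (hP₂ t ht) (hX t ht)) fun t ht => ?_
  refine Matrix.PosSemidef.transpose_mul_mul ?_ _
  have h := (hS t).transpose_mul_mul (P₁ t - P₂ t)
  rwa [transpose_sub, hP₁ t ht, hP₂ t ht] at h

end Riccati

/-! ### The Hamiltonian system -/

section Hamiltonian

open scoped Matrix.Norms.Operator

variable {n : Type*} [Fintype n] {A S Q : ℝ → Matrix n n ℝ}

/-- `(X, Y)` solves the linear Hamiltonian system `X' = AX - SY`, `Y' = -QX - AᵀY` on `ℝ`, the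
linearization of the Riccati equation through `P = Y X⁻¹`. -/
structure IsHamiltonianSol (A S Q X Y : ℝ → Matrix n n ℝ) : Prop where
  left : ∀ t, HasDerivAt X (A t * X t - S t * Y t) t
  right : ∀ t, HasDerivAt Y (-(Q t * X t) - (A t)ᵀ * Y t) t

namespace IsHamiltonianSol

variable {X Y X₁ Y₁ X₂ Y₂ : ℝ → Matrix n n ℝ}

theorem sub_const (h : IsHamiltonianSol A S Q X Y) {c : ℝ} (hA : Function.Periodic A c)
    (hS : Function.Periodic S c) (hQ : Function.Periodic Q c) :
    IsHamiltonianSol A S Q (fun t => X (t - c)) (fun t => Y (t - c)) where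
  left t := by
    refine ((h.left (t - c)).comp_sub_const t c).congr_deriv ?_
    rw [hA.sub_eq, hS.sub_eq]
  right t := by
    refine ((h.right (t - c)).comp_sub_const t c).congr_deriv ?_
    rw [hA.sub_eq, hQ.sub_eq]

theorem continuous_left (h : IsHamiltonianSol A S Q X Y) : Continuous X :=
  continuous_iff_continuousAt.2 fun t => (h.left t).continuousAt

theorem continuous_right (h : IsHamiltonianSol A S Q X Y) : Continuous Y :=
  continuous_iff_continuousAt.2 fun t => (h.right t).continuousAt

theorem posSemidef_energy_deriv (hS : ∀ t, (S t).PosSemidef) (hQ : ∀ t, (Q t).PosSemidef) (t : ℝ) :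
    ((Y t)ᵀ * S t * Y t + (X t)ᵀ * Q t * X t).PosSemidef :=
  ((hS t).transpose_mul_mul _).add ((hQ t).transpose_mul_mul _)

variable [DecidableEq n]

theorem mul_const (h : IsHamiltonianSol A S Q X Y) (M : Matrix n n ℝ) :
    IsHamiltonianSol A S Q (fun t => X t * M) (fun t => Y t * M) where
  left t := by
    refine ((h.left t).mul_const M).congr_deriv ?_
    noncomm_ring
  right t := by
    refine ((h.right t).mul_const M).congr_deriv ?_
    noncomm_ring

theorem add (h₁ : IsHamiltonianSol A S Q X₁ Y₁) (h₂ : IsHamiltonianSol A S Q X₂ Y₂) :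
    IsHamiltonianSol A S Q (fun t => X₁ t + X₂ t) (fun t => Y₁ t + Y₂ t) where
  left t := by
    refine ((h₁.left t).add (h₂.left t)).congr_deriv ?_
    noncomm_ring
  right t := by
    refine ((h₁.right t).add (h₂.right t)).congr_deriv ?_
    noncomm_ring

theorem eq_zero (h : IsHamiltonianSol A S Q X Y) (hA : Continuous A) (hS : Continuous S)
    (hQ : Continuous Q) {t₀ : ℝ} (hX : X t₀ = 0) (hY : Y t₀ = 0) (t : ℝ) : X t = 0 ∧ Y t = 0 := by
  have key : ∀ a b c : ℝ, (c = a ∨ c = b) → X c = 0 → Y c = 0 →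
      ∀ s ∈ Set.Icc a b, X s = 0 ∧ Y s = 0 := by
    intro a b c hc hX hY s hs
    obtain ⟨K, hK⟩ := (isCompact_Icc (a := a) (b := b)).exists_bound_of_continuousOn
      (f := fun t => ‖A t‖ + ‖S t‖ + ‖Q t‖ + ‖(A t)ᵀ‖) (by
        have hA' : Continuous fun t => (A t)ᵀ := hA.matrix_transpose
        exact (((hA.norm.add hS.norm).add hQ.norm).add hA'.norm).continuousOn)
    have := eq_zero_of_norm_deriv_le (f := fun t => (X t, Y t)) (K := K) (c := c) (a := a) (b := b)
      (f' := fun t => (A t * X t - S t * Y t, -(Q t * X t) - (A t)ᵀ * Y t))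
      (fun t _ => ((h.left t).prodMk (h.right t)).hasDerivWithinAt)
      (fun t ht => by
        have hKt := (le_abs_self _).trans (hK t ht)
        have hx : ‖X t‖ ≤ ‖(X t, Y t)‖ := norm_fst_le (X t, Y t)
        have hy : ‖Y t‖ ≤ ‖(X t, Y t)‖ := norm_snd_le (X t, Y t)
        refine le_trans ?_ (mul_le_mul_of_nonneg_right hKt (norm_nonneg _))
        refine max_le ?_ ?_
        · calc ‖A t * X t - S t * Y t‖ ≤ ‖A t‖ * ‖X t‖ + ‖S t‖ * ‖Y t‖ :=
                (norm_sub_le _ _).trans (add_le_add (norm_mul_le _ _) (norm_mul_le _ _))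
            _ ≤ ‖A t‖ * ‖(X t, Y t)‖ + ‖S t‖ * ‖(X t, Y t)‖ := by gcongr
            _ ≤ _ := by
              nlinarith [mul_nonneg (norm_nonneg (Q t)) (norm_nonneg (X t, Y t)),
                mul_nonneg (norm_nonneg (A t)ᵀ) (norm_nonneg (X t, Y t))]
        · calc ‖-(Q t * X t) - (A t)ᵀ * Y t‖ ≤ ‖Q t‖ * ‖X t‖ + ‖(A t)ᵀ‖ * ‖Y t‖ :=
                (norm_sub_le _ _).trans (add_le_add
                  ((norm_neg _).trans_le (norm_mul_le _ _)) (norm_mul_le _ _))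
            _ ≤ ‖Q t‖ * ‖(X t, Y t)‖ + ‖(A t)ᵀ‖ * ‖(X t, Y t)‖ := by gcongr
            _ ≤ _ := by
              nlinarith [mul_nonneg (norm_nonneg (A t)) (norm_nonneg (X t, Y t)),
                mul_nonneg (norm_nonneg (S t)) (norm_nonneg (X t, Y t))])
      hc (by simp [hX, hY]) s hs
    exact ⟨congrArg Prod.fst this, congrArg Prod.snd this⟩
  rcases le_total t₀ t with h0 | h0
  · exact key t₀ t t₀ (.inl rfl) hX hY t ⟨h0, le_rfl⟩
  · exact key t t₀ t₀ (.inr rfl) hX hY t ⟨le_rfl, h0⟩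

theorem unique (h₁ : IsHamiltonianSol A S Q X₁ Y₁) (h₂ : IsHamiltonianSol A S Q X₂ Y₂)
    (hA : Continuous A) (hS : Continuous S) (hQ : Continuous Q) {t₀ : ℝ}
    (hX : X₁ t₀ = X₂ t₀) (hY : Y₁ t₀ = Y₂ t₀) (t : ℝ) : X₁ t = X₂ t ∧ Y₁ t = Y₂ t := by
  have := (h₁.add (h₂.mul_const (-1))).eq_zero hA hS hQ (t₀ := t₀) (by simp [hX]) (by simp [hY]) t
  simpa [← sub_eq_add_neg, sub_eq_zero] using this

/-- The energy `XᵀY` is nonincreasing; it is negated to have a positive semidefinite derivative. -/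
theorem hasDerivAt_energy (h : IsHamiltonianSol A S Q X Y) {t : ℝ} (hS : (S t)ᵀ = S t) :
    HasDerivAt (fun τ => -((X τ)ᵀ * Y τ))
      ((Y t)ᵀ * S t * Y t + (X t)ᵀ * Q t * X t) t := by
  refine ((h.left t).matrix_transpose.mul (h.right t)).neg.congr_deriv ?_
  simp only [transpose_mul, transpose_sub, hS]
  noncomm_ring

theorem posSemidef_transpose_mul (h : IsHamiltonianSol A S Q X Y) (hS : ∀ t, (S t).PosSemidef)
    (hQ : ∀ t, (Q t).PosSemidef) {a b : ℝ} (hab : a ≤ b) (hb : ((X b)ᵀ * Y b).PosSemidef) :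
    ((X a)ᵀ * Y a).PosSemidef := by
  have := posSemidef_sub_of_deriv hab
    (fun t _ => (h.hasDerivAt_energy (hS t).transpose_eq).hasDerivWithinAt)
    (fun t _ => posSemidef_energy_deriv (X := X) (Y := Y) hS hQ t)
  have h2 := this.add hb
  simpa using h2

/-- With a positive semidefinite final value, the first block of the Hamiltonian system stays
invertible backwards in time: a kernel vector `v` of `X a` would make the energy `vᵀXᵀYv`
constant on `[a, b]`, so that `S Y v = 0` there and `X v` would solve the linear equation
`x' = A x` with a zero initial value. -/
theorem isUnit_left (h : IsHamiltonianSol A S Q X Y) (hA : Continuous A)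
    (hS : ∀ t, (S t).PosSemidef) (hQ : ∀ t, (Q t).PosSemidef) {a b : ℝ} (hab : a ≤ b)
    (hX : X b = 1) (hY : (Y b).PosSemidef) : IsUnit (X a) := by
  rcases hab.eq_or_lt with rfl | hlt
  · simp [hX]
  by_contra hu
  rw [isUnit_iff_isUnit_det, isUnit_iff_ne_zero, not_not] at hu
  obtain ⟨v, hv0, hv⟩ := exists_mulVec_eq_zero_iff.2 hu
  have hzero := quadForm_deriv_eq_zero hlt (v := v)
    (fun t _ => (h.hasDerivAt_energy (hS t).transpose_eq).hasDerivWithinAt)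
    (fun t _ => posSemidef_energy_deriv (X := X) (Y := Y) hS hQ t) (by
      have h1 : v ⬝ᵥ ((X a)ᵀ * Y a) *ᵥ v = 0 := by
        rw [← mulVec_mulVec, dotProduct_mulVec, vecMul_transpose, hv, zero_dotProduct]
      have h2 := hY.quadForm_nonneg v
      simp only [neg_mulVec, dotProduct_neg, h1, hX, transpose_one, one_mul]
      linarith)
  obtain ⟨K, hK⟩ := (isCompact_Icc (a := a) (b := b)).exists_bound_of_continuousOn
    hA.continuousOn
  have hXv := eq_zero_of_norm_deriv_le (f := fun t => X t *ᵥ v) (K := K) (c := a)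
    (f' := fun t => A t *ᵥ (X t *ᵥ v)) (a := a) (b := b) (fun t ht => by
      have h1 := hzero t ht
      rw [add_mulVec, dotProduct_add, quadForm_transpose_mul_mul,
        quadForm_transpose_mul_mul] at h1
      have h2 := (hS t).quadForm_nonneg (Y t *ᵥ v)
      have h3 := (hQ t).quadForm_nonneg (X t *ᵥ v)
      have h4 : S t *ᵥ (Y t *ᵥ v) = 0 :=
        ((hS t).dotProduct_mulVec_zero_iff _).1 (by rw [star_trivial]; linarith)
      refine ((h.left t).hasDerivWithinAt.mulVec_const v).congr_deriv ?_
      rw [sub_mulVec, ← mulVec_mulVec, ← mulVec_mulVec, h4, sub_zero])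
    (fun t ht => (linfty_opNorm_mulVec _ _).trans
      (mul_le_mul_of_nonneg_right (hK t ht) (norm_nonneg _)))
    (.inl rfl) hv b ⟨hab, le_rfl⟩
  rw [hX, one_mulVec] at hXv
  exact hv0 hXv

theorem closedLoop_eq {t : ℝ} (hu : IsUnit (X t)) :
    (A t - S t * (Y t * (X t)⁻¹)) * X t = A t * X t - S t * Y t := by
  rw [sub_mul, mul_assoc (S t), mul_assoc (Y t),
    nonsing_inv_mul _ ((isUnit_iff_isUnit_det _).1 hu), mul_one]

/-- The first block of the Hamiltonian system solves the closed loop of `P = Y X⁻¹`. -/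
theorem hasDerivAt_closedLoop (h : IsHamiltonianSol A S Q X Y) {t : ℝ} (hu : IsUnit (X t)) :
    HasDerivAt X ((A t - S t * (Y t * (X t)⁻¹)) * X t) t :=
  closedLoop_eq (A := A) (S := S) (Y := Y) hu ▸ h.left t

theorem hasDerivAt_riccati (h : IsHamiltonianSol A S Q X Y) {t : ℝ} (hu : IsUnit (X t)) :
    HasDerivAt (fun τ => Y τ * (X τ)⁻¹) (-riccatiField A S Q t (Y t * (X t)⁻¹)) t := by
  have hinv : HasDerivAt (fun τ => (X τ)⁻¹) (-((X t)⁻¹ * (A t * X t - S t * Y t) * (X t)⁻¹)) t := by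
    obtain ⟨u, hu'⟩ := hu
    have h1 := hasFDerivAt_ringInverse (𝕜 := ℝ) u
    rw [hu'] at h1
    have h2 := h1.comp_hasDerivAt t (h.left t)
    have h3 : (↑u⁻¹ : Matrix n n ℝ) = (X t)⁻¹ := by rw [coe_units_inv, hu']
    simp only [nonsing_inv_eq_ringInverse]
    rw [h3] at h2
    refine h2.congr_deriv ?_
    simp [nonsing_inv_eq_ringInverse]
  have hd := (isUnit_iff_isUnit_det _).1 hu
  refine ((h.right t).mul hinv).congr_deriv ?_
  have h1 : X t * (X t)⁻¹ = 1 := mul_nonsing_inv _ hd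
  calc _ = -(Q t) * (X t * (X t)⁻¹) - (A t)ᵀ * Y t * (X t)⁻¹
        - Y t * (X t)⁻¹ * A t * (X t * (X t)⁻¹) + Y t * (X t)⁻¹ * S t * (Y t * (X t)⁻¹) := by
        noncomm_ring
    _ = -(Q t) - (A t)ᵀ * Y t * (X t)⁻¹ - Y t * (X t)⁻¹ * A t
        + Y t * (X t)⁻¹ * S t * (Y t * (X t)⁻¹) := by
        rw [h1, mul_one, mul_one]
    _ = _ := by simp only [riccatiField]; noncomm_ring

/-- `P = Y X⁻¹` is congruent to the energy: `P = (X⁻¹)ᵀ (XᵀY) X⁻¹`. -/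
theorem posSemidef_riccati (h : IsHamiltonianSol A S Q X Y) (hA : Continuous A)
    (hS : ∀ t, (S t).PosSemidef) (hQ : ∀ t, (Q t).PosSemidef) {a b : ℝ} (hab : a ≤ b)
    (hX : X b = 1) (hY : (Y b).PosSemidef) : (Y a * (X a)⁻¹).PosSemidef := by
  have hu := (isUnit_iff_isUnit_det _).1 (h.isUnit_left hA hS hQ hab hX hY)
  have h1 := (h.posSemidef_transpose_mul hS hQ hab (by simpa [hX] using hY)).transpose_mul_mul
    (X a)⁻¹
  have h2 : ((X a)⁻¹)ᵀ * (X a)ᵀ = 1 := by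
    rw [← transpose_mul, mul_nonsing_inv _ hu, transpose_one]
  rwa [← mul_assoc, h2, one_mul] at h1

end IsHamiltonianSol

/-- The solutions of the Hamiltonian system with values `(1, G)` at time `b`, jointly continuous in
`G` and in time. -/
theorem exists_hamiltonian_family [DecidableEq n] (hA : Continuous A) (hS : Continuous S)
    (hQ : Continuous Q) (b : ℝ) : ∃ X Y : Matrix n n ℝ → ℝ → Matrix n n ℝ,
      (∀ G, IsHamiltonianSol A S Q (X G) (Y G) ∧ X G b = 1 ∧ Y G b = G) ∧
      Continuous (fun z : Matrix n n ℝ × ℝ => X z.1 z.2) ∧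
      Continuous (fun z : Matrix n n ℝ × ℝ => Y z.1 z.2) := by
  have hH : Continuous fun t => fromBlocks (A t) (-S t) (-Q t) (-(A t)ᵀ) :=
    hA.matrix_fromBlocks hS.neg hQ.neg hA.matrix_transpose.neg
  obtain ⟨W, hWb, hW⟩ := exists_fundamental_solution hH b
  -- Block columns of the fundamental matrix `W` are Hamiltonian solutions with values `(1, 0)` and
  -- `(0, 1)` at `b`; the solution through `(1, G)` is the first plus the second times `G`.
  have hW' : ∀ t, HasDerivAt W (fromBlocks (A t) (-S t) (-Q t) (-(A t)ᵀ) *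
      fromBlocks (W t).toBlocks₁₁ (W t).toBlocks₁₂ (W t).toBlocks₂₁ (W t).toBlocks₂₂) t :=
    fun t => by rw [fromBlocks_toBlocks]; exact hW t
  simp only [fromBlocks_multiply] at hW'
  have h₁ : IsHamiltonianSol A S Q (fun t => (W t).toBlocks₁₁) (fun t => (W t).toBlocks₂₁) :=
    ⟨fun t => hasDerivAt_matrix.2 fun i j =>
      (hasDerivAt_matrix.1 (hW' t) (.inl i) (.inl j)).congr_deriv (by simp [sub_eq_add_neg]),
    fun t => hasDerivAt_matrix.2 fun i j =>
      (hasDerivAt_matrix.1 (hW' t) (.inr i) (.inl j)).congr_deriv (by simp [sub_eq_add_neg])⟩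
  have h₂ : IsHamiltonianSol A S Q (fun t => (W t).toBlocks₁₂) (fun t => (W t).toBlocks₂₂) :=
    ⟨fun t => hasDerivAt_matrix.2 fun i j =>
      (hasDerivAt_matrix.1 (hW' t) (.inl i) (.inr j)).congr_deriv (by simp [sub_eq_add_neg]),
    fun t => hasDerivAt_matrix.2 fun i j =>
      (hasDerivAt_matrix.1 (hW' t) (.inr i) (.inr j)).congr_deriv (by simp [sub_eq_add_neg])⟩
  rw [← fromBlocks_one] at hWb
  have hWb₁₁ : (W b).toBlocks₁₁ = 1 := by rw [hWb, toBlocks_fromBlocks₁₁]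
  have hWb₁₂ : (W b).toBlocks₁₂ = 0 := by rw [hWb, toBlocks_fromBlocks₁₂]
  have hWb₂₁ : (W b).toBlocks₂₁ = 0 := by rw [hWb, toBlocks_fromBlocks₂₁]
  have hWb₂₂ : (W b).toBlocks₂₂ = 1 := by rw [hWb, toBlocks_fromBlocks₂₂]
  refine ⟨fun G t => (W t).toBlocks₁₁ + (W t).toBlocks₁₂ * G,
    fun G t => (W t).toBlocks₂₁ + (W t).toBlocks₂₂ * G,
    fun G => ⟨h₁.add (h₂.mul_const G), by simp [hWb₁₁, hWb₁₂], by simp [hWb₂₁, hWb₂₂]⟩, ?_, ?_⟩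
  · exact (h₁.continuous_left.comp continuous_snd).add
      ((h₂.continuous_left.comp continuous_snd).mul continuous_fst)
  · exact (h₁.continuous_right.comp continuous_snd).add
      ((h₂.continuous_right.comp continuous_snd).mul continuous_fst)

end Hamiltonian

/-! ### Quadratic forms and limits -/

section QuadForm

open scoped Matrix.Norms.Operator

variable {n : Type*} [Fintype n] [DecidableEq n]

theorem Matrix.PosSemidef.of_conj {M X : Matrix n n ℝ} (hX : IsUnit X)
    (h : (Xᵀ * M * X).PosSemidef) : M.PosSemidef := by
  have hu := (isUnit_iff_isUnit_det _).1 hX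
  have h1 := h.transpose_mul_mul X⁻¹
  have h2 : (X⁻¹)ᵀ * Xᵀ = 1 := by rw [← transpose_mul, mul_nonsing_inv _ hu, transpose_one]
  have h3 : (X⁻¹)ᵀ * (Xᵀ * M * X) * X⁻¹ = ((X⁻¹)ᵀ * Xᵀ) * M * (X * X⁻¹) := by noncomm_ring
  rwa [h3, h2, mul_nonsing_inv _ hu, one_mul, mul_one] at h1

omit [DecidableEq n] in
theorem quadForm_le_of_posSemidef_sub {M N : Matrix n n ℝ} (h : (N - M).PosSemidef) (v : n → ℝ) :
    v ⬝ᵥ M *ᵥ v ≤ v ⬝ᵥ N *ᵥ v := by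
  have := h.quadForm_nonneg v
  rwa [sub_mulVec, dotProduct_sub, sub_nonneg] at this

theorem apply_eq_quadForm {M : Matrix n n ℝ} (hM : Mᵀ = M) (i j : n) :
    M i j = ((Pi.single i 1 + Pi.single j 1) ⬝ᵥ M *ᵥ (Pi.single i 1 + Pi.single j 1)
      - Pi.single i 1 ⬝ᵥ M *ᵥ Pi.single i 1 - Pi.single j 1 ⬝ᵥ M *ᵥ Pi.single j 1) / 2 := by
  have h : M j i = M i j := congrFun (congrFun hM i) j
  simp only [mulVec_add, dotProduct_add, add_dotProduct, mulVec_single_one,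
    single_one_dotProduct, col_apply, h]
  ring

/-- By polarization, convergence of all quadratic forms of symmetric matrices implies convergence
of the matrices. -/
theorem tendsto_of_quadForm {G : ℕ → Matrix n n ℝ} (hG : ∀ k, (G k)ᵀ = G k)
    {l : (n → ℝ) → ℝ}
    (hl : ∀ v, Filter.Tendsto (fun k => v ⬝ᵥ G k *ᵥ v) Filter.atTop (nhds (l v))) :
    Filter.Tendsto G Filter.atTop (nhds (of fun i j => (l (Pi.single i 1 + Pi.single j 1)
      - l (Pi.single i 1) - l (Pi.single j 1)) / 2)) := by
  refine tendsto_pi_nhds.2 fun i => tendsto_pi_nhds.2 fun j => ?_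
  have := (((hl (Pi.single i 1 + Pi.single j 1)).sub (hl (Pi.single i 1))).sub
    (hl (Pi.single j 1))).div_const 2
  exact this.congr fun k => (apply_eq_quadForm (hG k) i j).symm

theorem tendsto_zero_of_quadForm {G : ℕ → Matrix n n ℝ} (hG : ∀ k, (G k)ᵀ = G k)
    (hl : ∀ v, Filter.Tendsto (fun k => v ⬝ᵥ G k *ᵥ v) Filter.atTop (nhds 0)) :
    Filter.Tendsto G Filter.atTop (nhds 0) := by
  convert tendsto_of_quadForm hG hl using 2
  ext
  simp

omit [DecidableEq n] in
theorem tendsto_quadForm {ι : Type*} {l : Filter ι} {G : ι → Matrix n n ℝ} {G₀ : Matrix n n ℝ}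
    (h : Filter.Tendsto G l (nhds G₀)) (v : n → ℝ) :
    Filter.Tendsto (fun k => v ⬝ᵥ G k *ᵥ v) l (nhds (v ⬝ᵥ G₀ *ᵥ v)) := by
  have hc : Continuous fun M : Matrix n n ℝ => v ⬝ᵥ M *ᵥ v :=
    continuous_const.dotProduct (continuous_id.matrix_mulVec continuous_const)
  exact (hc.tendsto G₀).comp h

omit [DecidableEq n] in
theorem posSemidef_of_tendsto {G : ℕ → Matrix n n ℝ} {G₀ : Matrix n n ℝ}
    (h : Filter.Tendsto G Filter.atTop (nhds G₀)) (hG : ∀ k, (G k).PosSemidef) :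
    G₀.PosSemidef := by
  refine posSemidef_iff_real.2 ⟨?_, fun v =>
    ge_of_tendsto' (tendsto_quadForm h v) fun k => (hG k).quadForm_nonneg v⟩
  have h1 : Filter.Tendsto (fun k => (G k)ᵀ) Filter.atTop (nhds G₀ᵀ) :=
    ((continuous_id.matrix_transpose).tendsto G₀).comp h
  simp only [(hG _).transpose_eq] at h1
  exact tendsto_nhds_unique h1 h

theorem abs_quadForm_le (M : Matrix n n ℝ) (v : n → ℝ) :
    |v ⬝ᵥ M *ᵥ v| ≤ Fintype.card n * ‖M‖ * ‖v‖ ^ 2 := by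
  calc |v ⬝ᵥ M *ᵥ v| ≤ ∑ i, |v i * (M *ᵥ v) i| := Finset.abs_sum_le_sum_abs _ _
    _ ≤ ∑ _i : n, ‖v‖ * (‖M‖ * ‖v‖) := Finset.sum_le_sum fun i _ => by
        rw [abs_mul]
        exact mul_le_mul (norm_le_pi_norm v i)
          ((norm_le_pi_norm (M *ᵥ v) i).trans (linfty_opNorm_mulVec M v)) (abs_nonneg _)
          (norm_nonneg _)
    _ = _ := by
        rw [Finset.sum_const, Finset.card_univ, nsmul_eq_mul]
        ring

end QuadForm

/-! ### The period map and its fixed point -/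

section PeriodicFlow

open scoped Matrix.Norms.Operator

variable {n : Type*} [Fintype n]

/-- Continuous `T`-periodic coefficients of a Riccati equation, with `S` and `Q` positive
semidefinite. -/
structure IsPeriodicRiccatiData (T : ℝ) (A S Q : ℝ → Matrix n n ℝ) : Prop where
  pos : 0 < T
  contA : Continuous A
  contS : Continuous S
  contQ : Continuous Q
  perA : Function.Periodic A T
  perS : Function.Periodic S T
  perQ : Function.Periodic Q T
  posS : ∀ t, (S t).PosSemidef
  posQ : ∀ t, (Q t).PosSemidef

variable [DecidableEq n]

/-- `X G, Y G` is the solution of the Hamiltonian system with value `(1, G)` at time `0`, depending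
continuously on `G` and on time. -/
structure IsHamiltonianFamily (A S Q : ℝ → Matrix n n ℝ) (X Y : Matrix n n ℝ → ℝ → Matrix n n ℝ) :
    Prop where
  sol : ∀ G, IsHamiltonianSol A S Q (X G) (Y G)
  left_zero : ∀ G, X G 0 = 1
  right_zero : ∀ G, Y G 0 = G
  continuous_left : Continuous fun z : Matrix n n ℝ × ℝ => X z.1 z.2
  continuous_right : Continuous fun z : Matrix n n ℝ × ℝ => Y z.1 z.2

/-- The solution `Y X⁻¹` of the Riccati equation with value `G` at time `0`. It is meaningful where
`X G t` is invertible, in particular for `t ≤ 0` and positive semidefinite `G`. -/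
noncomputable def riccatiFlow (X Y : Matrix n n ℝ → ℝ → Matrix n n ℝ) (G : Matrix n n ℝ) (t : ℝ) :
    Matrix n n ℝ :=
  Y G t * (X G t)⁻¹

namespace IsHamiltonianFamily

variable {T : ℝ} {A S Q : ℝ → Matrix n n ℝ} {X Y : Matrix n n ℝ → ℝ → Matrix n n ℝ}
  {G G₁ G₂ : Matrix n n ℝ} {t : ℝ}

theorem isUnit (F : IsHamiltonianFamily A S Q X Y) (h : IsPeriodicRiccatiData T A S Q)
    (hG : G.PosSemidef) (ht : t ≤ 0) : IsUnit (X G t) :=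
  (F.sol G).isUnit_left h.contA h.posS h.posQ ht (F.left_zero G) (by rwa [F.right_zero])

theorem flow_zero (F : IsHamiltonianFamily A S Q X Y) : riccatiFlow X Y G 0 = G := by
  simp [riccatiFlow, F.left_zero, F.right_zero]

theorem posSemidef_flow (F : IsHamiltonianFamily A S Q X Y) (h : IsPeriodicRiccatiData T A S Q)
    (hG : G.PosSemidef) (ht : t ≤ 0) : (riccatiFlow X Y G t).PosSemidef :=
  (F.sol G).posSemidef_riccati h.contA h.posS h.posQ ht (F.left_zero G) (by rwa [F.right_zero])

theorem isRiccatiSolOn_flow (F : IsHamiltonianFamily A S Q X Y)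
    (h : IsPeriodicRiccatiData T A S Q) (hG : G.PosSemidef) :
    IsRiccatiSolOn A S Q (Set.Iic 0) (riccatiFlow X Y G) :=
  fun _ ht => ((F.sol G).hasDerivAt_riccati (F.isUnit h hG ht)).hasDerivWithinAt

theorem continuousAt_flow (F : IsHamiltonianFamily A S Q X Y) (hu : IsUnit (X G t)) :
    ContinuousAt (fun z : Matrix n n ℝ × ℝ => riccatiFlow X Y z.1 z.2) (G, t) := by
  refine F.continuous_right.continuousAt.mul ?_
  have hd := (isUnit_iff_isUnit_det _).1 hu
  refine ContinuousAt.comp (g := fun M : Matrix n n ℝ => M⁻¹) (continuousAt_matrix_inv _ ?_)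
    F.continuous_left.continuousAt
  rw [Ring.inverse_eq_inv']
  exact continuousAt_inv₀ hd.ne_zero

/-- Semigroup property over whole periods. -/
theorem flow_sub_nat_mul (F : IsHamiltonianFamily A S Q X Y) (h : IsPeriodicRiccatiData T A S Q)
    (hG : G.PosSemidef) (ht : t ≤ 0) (k : ℕ) :
    riccatiFlow X Y G (t - k * T) = riccatiFlow X Y (riccatiFlow X Y G (-(k * T))) t := by
  have hk : 0 ≤ k * T := mul_nonneg k.cast_nonneg h.pos.le
  have h1 := ((F.isRiccatiSolOn_flow h hG).sub_const (h.perA.nat_mul k) (h.perS.nat_mul k)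
    (h.perQ.nat_mul k)).mono (s' := Set.Iic 0) (Set.Iic_subset_Iic.2 (by linarith))
  have h2 := F.isRiccatiSolOn_flow h (F.posSemidef_flow h hG (t := -(k * T)) (by linarith))
  exact h1.eqOn h.contA h.contS h2 (by simp [F.flow_zero]) ht

/-- Comparison of two solutions on `[t, 0]` along the closed loop of the second one. -/
theorem posSemidef_sub_conj (F : IsHamiltonianFamily A S Q X Y)
    (h : IsPeriodicRiccatiData T A S Q) (hG₁ : G₁.PosSemidef) (hG₂ : G₂.PosSemidef) (ht : t ≤ 0) :
    ((G₁ - G₂) - (X G₂ t)ᵀ * (riccatiFlow X Y G₁ t - riccatiFlow X Y G₂ t) *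
      X G₂ t).PosSemidef := by
  have := IsRiccatiSolOn.posSemidef_conj_sub (X := X G₂) ht
    ((F.isRiccatiSolOn_flow h hG₁).mono Set.Icc_subset_Iic_self)
    ((F.isRiccatiSolOn_flow h hG₂).mono Set.Icc_subset_Iic_self) h.posS
    (fun τ hτ => (F.posSemidef_flow h hG₁ hτ.2).transpose_eq)
    (fun τ hτ => (F.posSemidef_flow h hG₂ hτ.2).transpose_eq)
    (fun τ hτ => ((F.sol G₂).hasDerivAt_closedLoop (F.isUnit h hG₂ hτ.2)).hasDerivWithinAt)
  simpa [F.left_zero, F.flow_zero] using this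

theorem flow_mono (F : IsHamiltonianFamily A S Q X Y) (h : IsPeriodicRiccatiData T A S Q)
    (hG₁ : G₁.PosSemidef) (hG₂ : G₂.PosSemidef) (hG : (G₂ - G₁).PosSemidef) (ht : t ≤ 0) :
    (riccatiFlow X Y G₂ t - riccatiFlow X Y G₁ t).PosSemidef := by
  refine .of_conj (F.isUnit h hG₂ ht) ?_
  convert (F.posSemidef_sub_conj h hG₁ hG₂ ht).add hG using 1
  noncomm_ring

theorem flow_zero_mono (F : IsHamiltonianFamily A S Q X Y) (h : IsPeriodicRiccatiData T A S Q)
    (k : ℕ) :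
    (riccatiFlow X Y 0 (-((k + 1 : ℕ) * T)) - riccatiFlow X Y 0 (-(k * T))).PosSemidef := by
  have hT := h.pos
  have h1 := F.flow_sub_nat_mul h .zero (t := -(k * T))
    (by have : 0 ≤ k * T := by positivity
        linarith) 1
  have h2 := F.posSemidef_flow h .zero (t := -((1 : ℕ) * T)) (by simpa using hT.le)
  rw [show -((k + 1 : ℕ) * T) = -(k * T) - (1 : ℕ) * T by push_cast; ring, h1]
  exact F.flow_mono h .zero h2 (by simpa using h2) (by have : 0 ≤ k * T := by positivity
                                                       linarith)

/-- A feedback whose closed loop is `Acl`, with running cost `W`, bounds the Riccati flow over one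
period: `p G (-T) ≤ MᵀGM + J`, where `M` is the monodromy matrix of `Acl` and `J` is the cost of
the feedback over the period. -/
theorem exists_flow_period_le (F : IsHamiltonianFamily A S Q X Y)
    (h : IsPeriodicRiccatiData T A S Q) {Acl W Φ : ℝ → Matrix n n ℝ} (hW : Continuous W)
    (hΦ : ∀ t, HasDerivAt Φ (Acl t * Φ t) t) (hΦ0 : Φ 0 = 1)
    (hcl : ∀ t (P : Matrix n n ℝ), Pᵀ = P →
      (P * S t * P - Q t + (Acl t - A t)ᵀ * P + P * (Acl t - A t) + W t).PosSemidef) :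
    ∃ J : Matrix n n ℝ, ∀ G : Matrix n n ℝ, G.PosSemidef →
      ((Φ T)ᵀ * G * Φ T + J - riccatiFlow X Y G (-T)).PosSemidef := by
  have hΦc : Continuous Φ := continuous_iff_continuousAt.2 fun t => (hΦ t).continuousAt
  have hJc : Continuous fun t => (Φ t)ᵀ * W t * Φ t := (hΦc.matrix_transpose.mul hW).mul hΦc
  refine ⟨∫ s in (0 : ℝ)..T, (Φ s)ᵀ * W s * Φ s, fun G hG => ?_⟩
  have hsol := ((F.isRiccatiSolOn_flow h hG).sub_const h.perA h.perS h.perQ).mono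
    (s' := Set.Icc 0 T) (fun t ht => by simpa using ht.2)
  have key := posSemidef_sub_of_deriv h.pos.le
    (E := fun t => (Φ t)ᵀ * riccatiFlow X Y G (t - T) * Φ t +
      ∫ s in (0 : ℝ)..t, (Φ s)ᵀ * W s * Φ s)
    (E' := fun t => (Φ t)ᵀ * (riccatiFlow X Y G (t - T) * S t * riccatiFlow X Y G (t - T) - Q t
      + (Acl t - A t)ᵀ * riccatiFlow X Y G (t - T) + riccatiFlow X Y G (t - T) * (Acl t - A t)
      + W t) * Φ t)
    (fun t ht => by
      refine ((((hΦ t).matrix_transpose.hasDerivWithinAt.mul (hsol t ht)).mul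
        (hΦ t).hasDerivWithinAt).add
        (hJc.integral_hasStrictDerivAt 0 t).hasDerivAt.hasDerivWithinAt).congr_deriv ?_
      simp only [riccatiField, transpose_mul, transpose_sub, Pi.mul_apply]
      noncomm_ring)
    (fun t ht => (hcl t _ (F.posSemidef_flow h hG
      (by linarith [ht.2])).transpose_eq).transpose_mul_mul _)
  simpa [hΦ0, F.flow_zero] using key

/-- Iterating the one-period bound from `G = 0` sums the costs `(M ^ j v)ᵀ J (M ^ j v)`, a
convergent series for a stable `M`. -/
theorem exists_flow_zero_bound (F : IsHamiltonianFamily A S Q X Y)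
    (h : IsPeriodicRiccatiData T A S Q) {M J : Matrix n n ℝ}
    (hM : Summable fun k : ℕ => ‖M ^ k‖ ^ 2)
    (hJ : ∀ G : Matrix n n ℝ, G.PosSemidef →
      (Mᵀ * G * M + J - riccatiFlow X Y G (-T)).PosSemidef) (v : n → ℝ) :
    ∃ C : ℝ, ∀ k : ℕ, v ⬝ᵥ riccatiFlow X Y 0 (-(k * T)) *ᵥ v ≤ C := by
  have hT := h.pos
  have step : ∀ k : ℕ, ∀ v : n → ℝ, v ⬝ᵥ riccatiFlow X Y 0 (-(k * T)) *ᵥ v ≤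
      ∑ j ∈ Finset.range k, (M ^ j *ᵥ v) ⬝ᵥ J *ᵥ (M ^ j *ᵥ v) := by
    intro k
    induction k with
    | zero => intro v; simp [F.flow_zero]
    | succ k ih =>
      intro v
      have hk : -((k : ℝ) * T) ≤ 0 := by
        have : 0 ≤ k * T := by positivity
        linarith
      have h1 := quadForm_le_of_posSemidef_sub (hJ _ (F.posSemidef_flow h .zero hk)) v
      have h2 := F.flow_sub_nat_mul h .zero (t := -T) (by linarith) k
      rw [show -T - k * T = -((k + 1 : ℕ) * T) by push_cast; ring] at h2
      rw [← h2, add_mulVec, dotProduct_add, quadForm_transpose_mul_mul] at h1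
      rw [Finset.sum_range_succ']
      have h3 := ih (M *ᵥ v)
      simp only [mulVec_mulVec, ← pow_succ, pow_zero, one_mulVec] at h3 h1 ⊢
      linarith
  refine ⟨∑' j, Fintype.card n * ‖J‖ * ‖v‖ ^ 2 * ‖M ^ j‖ ^ 2, fun k => (step k v).trans ?_⟩
  refine le_trans (Finset.sum_le_sum fun j _ => ?_)
    ((hM.mul_left (Fintype.card n * ‖J‖ * ‖v‖ ^ 2)).sum_le_tsum (Finset.range k)
      fun j _ => by positivity)
  calc _ ≤ Fintype.card n * ‖J‖ * ‖M ^ j *ᵥ v‖ ^ 2 := (le_abs_self _).trans (abs_quadForm_le J _)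
    _ ≤ Fintype.card n * ‖J‖ * (‖M ^ j‖ * ‖v‖) ^ 2 := by
      gcongr
      exact linfty_opNorm_mulVec _ _
    _ = _ := by ring

/-- The values at `-kT` of the solution with zero final value increase to a fixed point of the
period map. -/
theorem exists_fixedPoint (F : IsHamiltonianFamily A S Q X Y) (h : IsPeriodicRiccatiData T A S Q)
    (hb : ∀ v, ∃ C : ℝ, ∀ k : ℕ, v ⬝ᵥ riccatiFlow X Y 0 (-(k * T)) *ᵥ v ≤ C) :
    ∃ G : Matrix n n ℝ, G.PosSemidef ∧ riccatiFlow X Y G (-T) = G ∧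
      Filter.Tendsto (fun k : ℕ => riccatiFlow X Y 0 (-(k * T))) Filter.atTop (nhds G) := by
  have hT := h.pos
  have hk : ∀ k : ℕ, -((k : ℝ) * T) ≤ 0 := fun k => by
    have : 0 ≤ k * T := by positivity
    linarith
  have hpsd := fun k : ℕ => F.posSemidef_flow h .zero (hk k)
  have hlim := tendsto_of_quadForm (fun k => (hpsd k).transpose_eq) fun v =>
    tendsto_atTop_ciSup
      (monotone_nat_of_le_succ fun k => quadForm_le_of_posSemidef_sub (F.flow_zero_mono h k) v)
      (let ⟨C, hC⟩ := hb v; ⟨C, Set.forall_mem_range.2 hC⟩)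
  -- The limit is a fixed point by continuity of the period map there.
  refine ⟨_, posSemidef_of_tendsto hlim hpsd, ?_, hlim⟩
  set G := of fun i j => _ with hGdef
  have hG : G.PosSemidef := posSemidef_of_tendsto hlim hpsd
  have h1 := ((F.continuousAt_flow (F.isUnit h hG (t := -T) (by linarith))).tendsto).comp
    (hlim.prodMk_nhds (tendsto_const_nhds (x := -T)))
  refine tendsto_nhds_unique h1 (((Filter.tendsto_add_atTop_iff_nat 1).2 hlim).congr fun k => ?_)
  have h2 := F.flow_sub_nat_mul h .zero (t := -T) (by linarith) k
  rw [show -T - k * T = -((k + 1 : ℕ) * T) by push_cast; ring] at h2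
  exact h2

section FixedPoint

variable (F : IsHamiltonianFamily A S Q X Y) (h : IsPeriodicRiccatiData T A S Q)
  (hG : G.PosSemidef) (hfix : riccatiFlow X Y G (-T) = G)

include F h hG hfix

/-- Both sides solve the Hamiltonian system and agree at time `0`, by the fixed point property. -/
theorem sub_period (t : ℝ) :
    X G (t - T) = X G t * X G (-T) ∧ Y G (t - T) = Y G t * X G (-T) := by
  have hT := h.pos
  refine ((F.sol G).sub_const h.perA h.perS h.perQ).unique ((F.sol G).mul_const (X G (-T)))
    h.contA h.contS h.contQ (t₀ := 0) (by simp [F.left_zero]) ?_ t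
  have hu := (isUnit_iff_isUnit_det _).1 (F.isUnit h hG (t := -T) (by linarith))
  calc Y G (0 - T) = Y G (-T) * ((X G (-T))⁻¹ * X G (-T)) := by
        rw [nonsing_inv_mul _ hu, mul_one, zero_sub]
    _ = riccatiFlow X Y G (-T) * X G (-T) := by rw [riccatiFlow, mul_assoc]
    _ = Y G 0 * X G (-T) := by rw [hfix, F.right_zero]

theorem left_sub_nat_mul (t : ℝ) (k : ℕ) : X G (t - k * T) = X G t * X G (-T) ^ k := by
  induction k with
  | zero => simp
  | succ k ih =>
    rw [show t - (k + 1 : ℕ) * T = t - k * T - T by push_cast; ring,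
      (F.sub_period h hG hfix _).1, ih, pow_succ, mul_assoc]

theorem isUnit_of_fixedPoint (t : ℝ) : IsUnit (X G t) := by
  obtain ⟨k, hk⟩ := exists_nat_ge (t / T)
  have ht : t - k * T ≤ 0 := by linarith [(div_le_iff₀ h.pos).1 hk]
  have h1 := (isUnit_iff_isUnit_det _).1 (F.isUnit h hG ht)
  rw [F.left_sub_nat_mul h hG hfix, det_mul] at h1
  exact (isUnit_iff_isUnit_det _).2 (isUnit_of_mul_isUnit_left h1)

theorem periodic_flow : Function.Periodic (riccatiFlow X Y G) T := by
  intro t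
  have h1 := F.sub_period h hG hfix (t + T)
  rw [add_sub_cancel_right] at h1
  have hu := (isUnit_iff_isUnit_det _).1 (F.isUnit_of_fixedPoint h hG hfix (-T))
  rw [riccatiFlow, riccatiFlow, h1.1, h1.2, Matrix.mul_inv_rev, mul_assoc, ← mul_assoc (X G (-T)),
    mul_nonsing_inv _ hu, one_mul]

theorem posSemidef_flow_of_fixedPoint (t : ℝ) : (riccatiFlow X Y G t).PosSemidef := by
  obtain ⟨k, hk⟩ := exists_nat_ge (t / T)
  have ht : t - k * T ≤ 0 := by linarith [(div_le_iff₀ h.pos).1 hk]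
  rw [← ((F.periodic_flow h hG hfix).nat_mul k).sub_eq t]
  exact F.posSemidef_flow h hG ht

theorem left_period_mul : X G T * X G (-T) = 1 := by
  have := (F.sub_period h hG hfix T).1
  rwa [sub_self, F.left_zero, eq_comm] at this

/-- If the closed loop of the fixed point is asymptotically stable, the values at `-kT` of every
solution with positive semidefinite final value converge to the fixed point: they lie between
those of the solution with final value `0` and an upper bound that decays along the closed loop. -/
theorem tendsto_flow_nat (hM : Filter.Tendsto (fun k : ℕ => X G T ^ k) Filter.atTop (nhds 0))
    (hlim : Filter.Tendsto (fun k : ℕ => riccatiFlow X Y 0 (-(k * T))) Filter.atTop (nhds G))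
    {G₁ : Matrix n n ℝ} (hG₁ : G₁.PosSemidef) :
    Filter.Tendsto (fun k : ℕ => riccatiFlow X Y G₁ (-(k * T))) Filter.atTop (nhds G) := by
  have hT := h.pos
  have hk : ∀ k : ℕ, -((k : ℝ) * T) ≤ 0 := fun k => by
    have : 0 ≤ k * T := by positivity
    linarith
  rw [← tendsto_sub_nhds_zero_iff]
  refine tendsto_zero_of_quadForm
    (fun k => by rw [transpose_sub, (F.posSemidef_flow h hG₁ (hk k)).transpose_eq,
      hG.transpose_eq]) fun v => ?_
  have hlow := tendsto_quadForm (hlim.sub_const G) v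
  have hup : Filter.Tendsto
      (fun k : ℕ => v ⬝ᵥ ((X G T ^ k)ᵀ * (G₁ - G) * X G T ^ k) *ᵥ v) Filter.atTop
      (nhds (v ⬝ᵥ ((0 : Matrix n n ℝ)ᵀ * (G₁ - G) * 0) *ᵥ v)) :=
    tendsto_quadForm (((((continuous_id.matrix_transpose).tendsto _).comp hM).mul_const _).mul hM) v
  simp only [sub_self, mul_zero, zero_mulVec, dotProduct_zero] at hlow hup
  refine tendsto_of_tendsto_of_tendsto_of_le_of_le hlow hup (fun k => ?_) (fun k => ?_)
  · refine quadForm_le_of_posSemidef_sub ?_ v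
    rw [sub_sub_sub_cancel_right]
    exact F.flow_mono h .zero hG₁ (by simpa using hG₁) (hk k)
  · refine quadForm_le_of_posSemidef_sub ?_ v
    have h1 := (F.posSemidef_sub_conj h hG₁ hG (hk k)).transpose_mul_mul (X G T ^ k)
    have h2 := F.left_sub_nat_mul h hG hfix 0 k
    rw [zero_sub, F.left_zero, one_mul] at h2
    have h3 : riccatiFlow X Y G (-(k * T)) = G := by
      have := ((F.periodic_flow h hG hfix).nat_mul k).sub_eq 0
      rwa [zero_sub, F.flow_zero] at this
    have h4 : X G (-T) ^ k * X G T ^ k = 1 := by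
      have hc : X G (-T) * X G T = 1 :=
        mul_eq_one_comm.1 (F.left_period_mul h hG hfix)
      have : Commute (X G (-T)) (X G T) :=
        hc.trans (F.left_period_mul h hG hfix).symm
      rw [← this.mul_pow, hc, one_pow]
    rw [h3, h2] at h1
    convert h1 using 1
    have h5 : (X G T ^ k)ᵀ * (X G (-T) ^ k)ᵀ = 1 := by rw [← transpose_mul, h4, transpose_one]
    set U := X G T ^ k
    set V := X G (-T) ^ k
    set D := riccatiFlow X Y G₁ (-(k * T)) - G
    have h6 : Uᵀ * (G₁ - G - Vᵀ * D * V) * U = Uᵀ * (G₁ - G) * U - (Uᵀ * Vᵀ) * D * (V * U) := by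
      noncomm_ring
    rw [h6, h5, h4, one_mul, mul_one]

/-- Convergence in continuous time. The flow is continuous at `G` uniformly over a period, so the
convergence at the times `-kT` extends to all phases. -/
theorem tendsto_flow (hM : Filter.Tendsto (fun k : ℕ => X G T ^ k) Filter.atTop (nhds 0))
    (hlim : Filter.Tendsto (fun k : ℕ => riccatiFlow X Y 0 (-(k * T))) Filter.atTop (nhds G))
    {G₁ : Matrix n n ℝ} (hG₁ : G₁.PosSemidef) :
    Filter.Tendsto (fun t => riccatiFlow X Y G₁ t - riccatiFlow X Y G t) Filter.atBot (nhds 0) := by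
  have hT := h.pos
  refine Metric.tendsto_nhds.2 fun ε hε => ?_
  have hnear : ∀ᶠ G' in nhds G, ∀ τ ∈ Set.Icc (-T) 0,
      dist (riccatiFlow X Y G' τ) (riccatiFlow X Y G τ) < ε := by
    refine isCompact_Icc.eventually_forall_of_forall_eventually fun τ hτ => ?_
    have hc := F.continuousAt_flow (F.isUnit h hG hτ.2)
    have hc2 : ContinuousAt (fun z : Matrix n n ℝ × ℝ => riccatiFlow X Y G z.2) (G, τ) :=
      ContinuousAt.comp (f := fun z : Matrix n n ℝ × ℝ => (G, z.2)) (x := (G, τ)) hc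
        (by fun_prop)
    have h1 := hc.tendsto.dist hc2.tendsto
    simp only [dist_self] at h1
    exact h1.eventually (gt_mem_nhds hε)
  obtain ⟨k₀, hk₀⟩ := Filter.eventually_atTop.1
    ((F.tendsto_flow_nat h hG hfix hM hlim hG₁).eventually hnear)
  filter_upwards [Filter.eventually_le_atBot (-(k₀ * T))] with t ht
  have hpos : 0 ≤ -t / T := by
    have : 0 ≤ k₀ * T := by positivity
    exact div_nonneg (by linarith) hT.le
  -- `t = τ - kT` with phase `τ ∈ [-T, 0]` and `k = ⌊-t / T⌋ ≥ k₀`.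
  have hk1 : k₀ ≤ ⌊-t / T⌋₊ := Nat.le_floor ((le_div_iff₀ hT).2 (by linarith))
  have hk2 := (le_div_iff₀ hT).1 (Nat.floor_le hpos)
  have hk3 := (div_lt_iff₀ hT).1 (Nat.lt_floor_add_one (-t / T))
  set k := ⌊-t / T⌋₊
  have hτ : t + k * T ∈ Set.Icc (-T) 0 := ⟨by linarith, by linarith⟩
  have h1 := hk₀ k hk1 (t + k * T) hτ
  rw [← F.flow_sub_nat_mul h hG₁ hτ.2, add_sub_cancel_right,
    (F.periodic_flow h hG hfix).nat_mul k t] at h1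
  rwa [dist_zero_right, ← dist_eq_norm]

end FixedPoint

end IsHamiltonianFamily

end PeriodicFlow

/-! ### Powers and eigenvectors of stable matrices -/

section Stability

open scoped Matrix.Norms.Operator

/-- If all complex eigenvalues of a real matrix lie in the open unit disk, its powers decay
geometrically, by Gelfand's formula. -/
theorem exists_norm_pow_le {n : ℕ} {M : Matrix (Fin n) (Fin n) ℝ}
    (hM : ∀ μ ∈ spectrum ℂ (M.map (algebraMap ℝ ℂ)), ‖μ‖ < 1) :
    ∃ q : ℝ, 0 ≤ q ∧ q < 1 ∧ ∀ᶠ k : ℕ in Filter.atTop, ‖M ^ k‖ ≤ q ^ k := by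
  -- Gelfand's formula needs a nontrivial algebra.
  rcases Nat.eq_zero_or_pos n with rfl | hn
  · refine ⟨0, le_rfl, one_pos, .of_forall fun k => ?_⟩
    rw [Subsingleton.elim (M ^ k) 0, norm_zero]
    positivity
  have : Nonempty (Fin n) := ⟨⟨0, hn⟩⟩
  set N := M.map (algebraMap ℝ ℂ) with hN
  have hρ : spectralRadius ℂ N < (1 : NNReal) :=
    spectrum.spectralRadius_lt_of_forall_lt N fun μ hμ => by
      rw [← NNReal.coe_lt_coe]; simpa using hM μ hμ
  obtain ⟨q, hq1, hq2⟩ := ENNReal.lt_iff_exists_nnreal_btwn.1 hρ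
  refine ⟨q, q.2, by exact_mod_cast hq2, ?_⟩
  have hlim := spectrum.pow_nnnorm_pow_one_div_tendsto_nhds_spectralRadius N
  filter_upwards [hlim.eventually_lt_const hq1, Filter.eventually_gt_atTop 0] with k hk hk0
  have hk0' : (0 : ℝ) < k := by exact_mod_cast hk0
  have h1 : (‖N ^ k‖₊ : ENNReal) < (q : ENNReal) ^ k := by
    rw [one_div, ENNReal.rpow_inv_lt_iff hk0'] at hk
    exact_mod_cast hk
  have h2 : ‖N ^ k‖₊ < q ^ k := by exact_mod_cast h1
  have h3 : ‖N ^ k‖₊ = ‖M ^ k‖₊ := by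
    have : N ^ k = (M ^ k).map (algebraMap ℝ ℂ) :=
      (map_pow (algebraMap ℝ ℂ).mapMatrix M k).symm
    rw [this]
    simp [linfty_opNNNorm_def]
  rw [h3] at h2
  exact_mod_cast h2.le

theorem summable_norm_pow_sq {n : ℕ} {M : Matrix (Fin n) (Fin n) ℝ}
    (hM : ∀ μ ∈ spectrum ℂ (M.map (algebraMap ℝ ℂ)), ‖μ‖ < 1) :
    Summable fun k : ℕ => ‖M ^ k‖ ^ 2 := by
  obtain ⟨q, hq0, hq1, hq⟩ := exists_norm_pow_le hM
  refine Summable.of_norm_bounded_eventually_nat (g := fun k => (q ^ 2) ^ k)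
    (summable_geometric_of_lt_one (by positivity) (by nlinarith)) ?_
  filter_upwards [hq] with k hk
  rw [norm_pow, norm_norm, ← pow_mul, mul_comm, pow_mul]
  gcongr

theorem tendsto_pow_zero {n : ℕ} {M : Matrix (Fin n) (Fin n) ℝ}
    (hM : ∀ μ ∈ spectrum ℂ (M.map (algebraMap ℝ ℂ)), ‖μ‖ < 1) :
    Filter.Tendsto (fun k : ℕ => M ^ k) Filter.atTop (nhds 0) := by
  obtain ⟨q, hq0, hq1, hq⟩ := exists_norm_pow_le hM
  exact squeeze_zero_norm' hq (tendsto_pow_atTop_nhds_zero_of_lt_one hq0 hq1)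

/-- A complex eigenvector of a real matrix, written through its real part `u` and its imaginary
part `w`. -/
theorem mem_spectrum_map_iff {n : ℕ} {M : Matrix (Fin n) (Fin n) ℝ} {μ : ℂ} :
    μ ∈ spectrum ℂ (M.map (algebraMap ℝ ℂ)) ↔ ∃ u w : Fin n → ℝ, (u ≠ 0 ∨ w ≠ 0) ∧
      M *ᵥ u = μ.re • u - μ.im • w ∧ M *ᵥ w = μ.im • u + μ.re • w := by
  have hspec : μ ∈ spectrum ℂ (M.map (algebraMap ℝ ℂ)) ↔
      ∃ z ≠ 0, M.map (algebraMap ℝ ℂ) *ᵥ z = μ • z := by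
    rw [spectrum.mem_iff, isUnit_iff_isUnit_det, isUnit_iff_ne_zero, not_not,
      ← exists_mulVec_eq_zero_iff]
    refine exists_congr fun z => and_congr_right fun _ => ?_
    rw [sub_mulVec, sub_eq_zero, Algebra.algebraMap_eq_smul_one, smul_mulVec, one_mulVec, eq_comm]
  have hre : ∀ z : Fin n → ℂ, ∀ i,
      ((M.map (algebraMap ℝ ℂ) *ᵥ z) i).re = (M *ᵥ fun j => (z j).re) i := fun z i => by
    simp [mulVec, dotProduct]
  have him : ∀ z : Fin n → ℂ, ∀ i,
      ((M.map (algebraMap ℝ ℂ) *ᵥ z) i).im = (M *ᵥ fun j => (z j).im) i := fun z i => by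
    simp [mulVec, dotProduct]
  rw [hspec]
  constructor
  · rintro ⟨z, hz, h⟩
    refine ⟨fun j => (z j).re, fun j => (z j).im, ?_, ?_, ?_⟩
    · by_contra! hc
      exact hz (funext fun j => Complex.ext (congrFun hc.1 j) (congrFun hc.2 j))
    · ext i
      rw [← hre, h]
      simp
    · ext i
      rw [← him, h]
      simp [add_comm]
  · rintro ⟨u, w, huw, hu, hw⟩
    refine ⟨fun j => ⟨u j, w j⟩, ?_, ?_⟩
    · intro hc
      rcases huw with hne | hne
      · exact hne (funext fun j => congrArg Complex.re (congrFun hc j))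
      · exact hne (funext fun j => congrArg Complex.im (congrFun hc j))
    · ext i
      refine Complex.ext ?_ ?_
      · rw [hre, hu]
        simp
      · rw [him, hw]
        simp [add_comm]

end Stability

/-! ### Detectability and the closed loop -/

section Stabilizing

open scoped Matrix.Norms.Operator

variable {n : Type*} [Fintype n] [DecidableEq n] {T : ℝ} {A S Q P X : ℝ → Matrix n n ℝ}

/-- The Lyapunov identity for a symmetric Riccati solution along its own closed loop. -/
theorem hasDerivAt_lyapunov {t : ℝ} (hS : (S t)ᵀ = S t) (hPt : (P t)ᵀ = P t)
    (hP : HasDerivAt P (-riccatiField A S Q t (P t)) t)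
    (hX : HasDerivAt X ((A t - S t * P t) * X t) t) :
    HasDerivAt (fun τ => -((X τ)ᵀ * P τ * X τ))
      ((X t)ᵀ * ((P t)ᵀ * S t * P t + Q t) * X t) t := by
  refine (((hX.matrix_transpose.mul hP).mul hX).neg).congr_deriv ?_
  simp only [riccatiField, transpose_mul, transpose_sub, hS, hPt, Pi.mul_apply]
  noncomm_ring

/-- A vector whose Lyapunov energy does not decrease over a period is moved by the closed loop in
the same way as by any `F` that agrees with `A` where the form of `Q` vanishes, such as the output
injection `A - LC` for `Q = CᵀC`: along its trajectory `x`, both `SPx` and `xᵀQx` vanish. -/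
theorem mulVec_eq_of_energy_le (hT : 0 < T) (hS : ∀ t, (S t).PosSemidef)
    (hQ : ∀ t, (Q t).PosSemidef) (hPt : ∀ t, (P t).PosSemidef)
    (hP : ∀ t, HasDerivAt P (-riccatiField A S Q t (P t)) t)
    (hX : ∀ t, HasDerivAt X ((A t - S t * P t) * X t) t) (hX0 : X 0 = 1)
    {F Φ : ℝ → Matrix n n ℝ} (hF : Continuous F) (hΦ : ∀ t, HasDerivAt Φ (F t * Φ t) t)
    (hΦ0 : Φ 0 = 1) (hFA : ∀ t v, v ⬝ᵥ Q t *ᵥ v = 0 → F t *ᵥ v = A t *ᵥ v) {v : n → ℝ}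
    (hv : v ⬝ᵥ P 0 *ᵥ v ≤ (X T *ᵥ v) ⬝ᵥ P T *ᵥ (X T *ᵥ v)) : X T *ᵥ v = Φ T *ᵥ v := by
  have hzero := quadForm_deriv_eq_zero hT (v := v)
    (fun t _ => (hasDerivAt_lyapunov (hS t).transpose_eq (hPt t).transpose_eq (hP t)
      (hX t)).hasDerivWithinAt)
    (fun t _ => (((hS t).transpose_mul_mul (P t)).add (hQ t)).transpose_mul_mul (X t)) (by
      rw [neg_mulVec, neg_mulVec, dotProduct_neg, dotProduct_neg, neg_le_neg_iff,
        quadForm_transpose_mul_mul, quadForm_transpose_mul_mul, hX0, one_mulVec]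
      exact hv)
  obtain ⟨K, hK⟩ := (isCompact_Icc (a := 0) (b := T)).exists_bound_of_continuousOn
    hF.continuousOn
  have key := eq_zero_of_norm_deriv_le (f := fun t => X t *ᵥ v - Φ t *ᵥ v) (K := K) (c := 0)
    (f' := fun t => F t *ᵥ (X t *ᵥ v - Φ t *ᵥ v)) (a := 0) (b := T) (fun t ht => by
      have h1 := hzero t ht
      rw [quadForm_transpose_mul_mul, add_mulVec, dotProduct_add,
        quadForm_transpose_mul_mul] at h1
      have h2 := (hS t).quadForm_nonneg (P t *ᵥ (X t *ᵥ v))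
      have h3 := (hQ t).quadForm_nonneg (X t *ᵥ v)
      have h4 : S t *ᵥ (P t *ᵥ (X t *ᵥ v)) = 0 :=
        ((hS t).dotProduct_mulVec_zero_iff _).1 (by rw [star_trivial]; linarith)
      have h5 : F t *ᵥ (X t *ᵥ v) = A t *ᵥ (X t *ᵥ v) := hFA t _ (by linarith)
      refine (((hX t).hasDerivWithinAt.mulVec_const v).sub
        ((hΦ t).hasDerivWithinAt.mulVec_const v)).congr_deriv ?_
      rw [← mulVec_mulVec, sub_mulVec, ← mulVec_mulVec, h4, sub_zero, mulVec_sub, h5,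
        mulVec_mulVec (M := F t)])
    (fun t ht => (linfty_opNorm_mulVec _ _).trans
      (mul_le_mul_of_nonneg_right (hK t ht) (norm_nonneg _)))
    (.inl rfl) (by simp [hX0, hΦ0]) T ⟨hT.le, le_rfl⟩
  exact sub_eq_zero.1 key

/-- Detectability makes a periodic positive semidefinite Riccati solution stabilizing: for a
multiplier `μ` of the closed loop with `1 ≤ ‖μ‖` the energy of an eigenvector cannot decrease over
the period, so `μ` is a multiplier of the output injection as well. -/
theorem norm_lt_one_of_mem_spectrum {n : ℕ} {A S Q P X : ℝ → Matrix (Fin n) (Fin n) ℝ}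
    (hT : 0 < T) (hS : ∀ t, (S t).PosSemidef)
    (hQ : ∀ t, (Q t).PosSemidef) (hPt : ∀ t, (P t).PosSemidef) (hper : P T = P 0)
    (hP : ∀ t, HasDerivAt P (-riccatiField A S Q t (P t)) t)
    (hX : ∀ t, HasDerivAt X ((A t - S t * P t) * X t) t) (hX0 : X 0 = 1)
    {F Φ : ℝ → Matrix (Fin n) (Fin n) ℝ} (hF : Continuous F)
    (hΦ : ∀ t, HasDerivAt Φ (F t * Φ t) t)
    (hΦ0 : Φ 0 = 1) (hFA : ∀ t v, v ⬝ᵥ Q t *ᵥ v = 0 → F t *ᵥ v = A t *ᵥ v)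
    (hstable : ∀ μ ∈ spectrum ℂ ((Φ T).map (algebraMap ℝ ℂ)), ‖μ‖ < 1) :
    ∀ μ ∈ spectrum ℂ ((X T).map (algebraMap ℝ ℂ)), ‖μ‖ < 1 := by
  intro μ hμ
  by_contra! hμ1
  obtain ⟨u, w, huw, hu, hw⟩ := mem_spectrum_map_iff.1 hμ
  -- The energy of each of `u` and `w` does not increase over the period, while their sum is
  -- multiplied by `‖μ‖ ^ 2 ≥ 1`; hence both energies are conserved.
  have hle : ∀ v, (X T *ᵥ v) ⬝ᵥ P 0 *ᵥ (X T *ᵥ v) ≤ v ⬝ᵥ P 0 *ᵥ v := by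
    intro v
    have h1 := posSemidef_sub_of_deriv hT.le
      (fun t _ => (hasDerivAt_lyapunov (hS t).transpose_eq (hPt t).transpose_eq (hP t)
        (hX t)).hasDerivWithinAt)
      (fun t _ => (((hS t).transpose_mul_mul (P t)).add (hQ t)).transpose_mul_mul (X t))
    have h2 := quadForm_le_of_posSemidef_sub h1 v
    rwa [neg_mulVec, neg_mulVec, dotProduct_neg, dotProduct_neg, neg_le_neg_iff,
      quadForm_transpose_mul_mul, quadForm_transpose_mul_mul, hX0, one_mulVec, hper] at h2
  have hsym : w ⬝ᵥ P 0 *ᵥ u = u ⬝ᵥ P 0 *ᵥ w := by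
    conv_lhs => rw [dotProduct_mulVec, ← mulVec_transpose, (hPt 0).transpose_eq, dotProduct_comm]
  have hsum : (X T *ᵥ u) ⬝ᵥ P 0 *ᵥ (X T *ᵥ u) + (X T *ᵥ w) ⬝ᵥ P 0 *ᵥ (X T *ᵥ w) =
      ‖μ‖ ^ 2 * (u ⬝ᵥ P 0 *ᵥ u + w ⬝ᵥ P 0 *ᵥ w) := by
    rw [hu, hw, Complex.sq_norm, Complex.normSq_apply]
    simp only [mulVec_sub, mulVec_add, mulVec_smul, dotProduct_sub, dotProduct_add, sub_dotProduct,
      add_dotProduct, dotProduct_smul, smul_dotProduct, smul_eq_mul, hsym]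
    ring
  have hge : u ⬝ᵥ P 0 *ᵥ u + w ⬝ᵥ P 0 *ᵥ w ≤
      (X T *ᵥ u) ⬝ᵥ P 0 *ᵥ (X T *ᵥ u) + (X T *ᵥ w) ⬝ᵥ P 0 *ᵥ (X T *ᵥ w) := by
    rw [hsum]
    exact le_mul_of_one_le_left
      (add_nonneg ((hPt 0).quadForm_nonneg u) ((hPt 0).quadForm_nonneg w)) (one_le_pow₀ hμ1)
  have hXΦ : ∀ v, v ⬝ᵥ P 0 *ᵥ v ≤ (X T *ᵥ v) ⬝ᵥ P 0 *ᵥ (X T *ᵥ v) → X T *ᵥ v = Φ T *ᵥ v :=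
    fun v hv => mulVec_eq_of_energy_le hT hS hQ hPt hP hX hX0 hF hΦ hΦ0 hFA (by rwa [hper])
  rw [hXΦ u (by linarith [hle w])] at hu
  rw [hXΦ w (by linarith [hle u])] at hw
  exact (hstable μ (mem_spectrum_map_iff.2 ⟨u, w, huw, hu, hw⟩)).not_ge hμ1

end Stabilizing

/-! ### The attracting periodic solution -/

section Main

open scoped Matrix.Norms.Operator

theorem eq_zero_of_periodic_of_tendsto {E : Type*} [TopologicalSpace E] [T2Space E] [Zero E]
    {f : ℝ → E} {T : ℝ} (hT : 0 < T) (hf : Function.Periodic f T)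
    (hlim : Filter.Tendsto f Filter.atBot (nhds 0)) (t : ℝ) : f t = 0 := by
  have h1 : Filter.Tendsto (fun k : ℕ => t - k * T) Filter.atTop Filter.atBot := by
    simp only [sub_eq_add_neg]
    exact Filter.tendsto_atBot_add_const_left _ t
      (Filter.tendsto_neg_atTop_atBot.comp (tendsto_natCast_atTop_atTop.atTop_mul_const hT))
  have h2 := hlim.comp h1
  refine tendsto_nhds_unique (tendsto_const_nhds.congr fun k => ?_) h2
  exact ((hf.nat_mul k).sub_eq t).symm

/-- Existence of a stabilizing periodic solution that attracts every positive semidefinite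
solution. The stabilizing feedback enters through its closed loop `Acl`, its running cost `W` and
the fundamental matrix `Φ`, the output injection through its closed loop `F` and the fundamental
matrix `Ψ`. -/
theorem exists_attracting_periodic_solution {n : ℕ} {T : ℝ}
    {A S Q : ℝ → Matrix (Fin n) (Fin n) ℝ} (h : IsPeriodicRiccatiData T A S Q)
    {Acl W Φ : ℝ → Matrix (Fin n) (Fin n) ℝ} (hW : Continuous W)
    (hΦ : ∀ t, HasDerivAt Φ (Acl t * Φ t) t) (hΦ0 : Φ 0 = 1)
    (hcl : ∀ t (P : Matrix (Fin n) (Fin n) ℝ), Pᵀ = P →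
      (P * S t * P - Q t + (Acl t - A t)ᵀ * P + P * (Acl t - A t) + W t).PosSemidef)
    (hΦs : ∀ μ ∈ spectrum ℂ ((Φ T).map (algebraMap ℝ ℂ)), ‖μ‖ < 1)
    {F Ψ : ℝ → Matrix (Fin n) (Fin n) ℝ} (hF : Continuous F)
    (hΨ : ∀ t, HasDerivAt Ψ (F t * Ψ t) t) (hΨ0 : Ψ 0 = 1)
    (hFA : ∀ t v, v ⬝ᵥ Q t *ᵥ v = 0 → F t *ᵥ v = A t *ᵥ v)
    (hΨs : ∀ μ ∈ spectrum ℂ ((Ψ T).map (algebraMap ℝ ℂ)), ‖μ‖ < 1) :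
    ∃ P : ℝ → Matrix (Fin n) (Fin n) ℝ,
      (∀ t, HasDerivAt P (-riccatiField A S Q t (P t)) t) ∧ Function.Periodic P T ∧
      (∀ t, (P t).PosSemidef) ∧ IsAsympStable T (fun t => A t - S t * P t) ∧
      ∀ (b : ℝ) (P₁ : ℝ → Matrix (Fin n) (Fin n) ℝ), IsRiccatiSolOn A S Q (Set.Iic b) P₁ →
        (∀ t ≤ b, (P₁ t).PosSemidef) →
        Filter.Tendsto (fun t => P₁ t - P t) Filter.atBot (nhds 0) := by
  obtain ⟨X, Y, hsol, hXc, hYc⟩ := exists_hamiltonian_family h.contA h.contS h.contQ 0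
  have fam : IsHamiltonianFamily A S Q X Y :=
    ⟨fun G => (hsol G).1, fun G => (hsol G).2.1, fun G => (hsol G).2.2, hXc, hYc⟩
  obtain ⟨J, hJ⟩ := fam.exists_flow_period_le h hW hΦ hΦ0 hcl
  obtain ⟨G, hG, hfix, hlim⟩ := fam.exists_fixedPoint h
    (fam.exists_flow_zero_bound h (summable_norm_pow_sq hΦs) hJ)
  have hu := fam.isUnit_of_fixedPoint h hG hfix
  have hper := fam.periodic_flow h hG hfix
  have hpsd := fam.posSemidef_flow_of_fixedPoint h hG hfix
  have hderiv := fun t => (fam.sol G).hasDerivAt_riccati (hu t)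
  have hXd := fun t => (fam.sol G).hasDerivAt_closedLoop (hu t)
  have hXs := norm_lt_one_of_mem_spectrum h.pos h.posS h.posQ hpsd hper.eq hderiv hXd
    (fam.left_zero G) hF hΨ hΨ0 hFA hΨs
  refine ⟨riccatiFlow X Y G, hderiv, hper, hpsd, ⟨fun t s => X G t * (X G s)⁻¹, ⟨fun s =>
    mul_nonsing_inv _ ((isUnit_iff_isUnit_det _).1 (hu s)), fun t s => ?_⟩, ?_⟩, ?_⟩
  · rw [← mul_assoc]
    exact (hXd t).mul_const _
  · simpa [fam.left_zero] using hXs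
  · intro b P₁ hP₁ hP₁s
    -- A shift by `N` periods reduces the final time `b` to the final time `0`.
    obtain ⟨N, hN⟩ := exists_nat_ge (-b / T)
    have hNb : -(N * T) ≤ b := by linarith [(div_le_iff₀ h.pos).1 hN]
    have hshift := (hP₁.sub_const (h.perA.nat_mul N) (h.perS.nat_mul N)
      (h.perQ.nat_mul N)).mono (s' := Set.Iic 0) (Set.Iic_subset_Iic.2 (by linarith))
    have hG₁ := hP₁s _ hNb
    have heq := hshift.eqOn h.contA h.contS (fam.isRiccatiSolOn_flow h hG₁)
      (by simp [fam.flow_zero])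
    refine ((fam.tendsto_flow h hG hfix (tendsto_pow_zero hXs) hlim hG₁).comp
      (Filter.tendsto_atBot_add_const_right _ (N * T) Filter.tendsto_id)).congr' ?_
    filter_upwards [Filter.eventually_le_atBot (-(N * T))] with t ht
    have h1 := heq (x := t + N * T) (Set.mem_Iic.2 (by linarith))
    simp only [add_sub_cancel_right] at h1
    simp only [Function.comp_apply, id, ← h1, hper.nat_mul N t]

theorem exists_final_value_solution {n : Type*} [Fintype n] [DecidableEq n] {T : ℝ}
    {A S Q : ℝ → Matrix n n ℝ}
    (h : IsPeriodicRiccatiData T A S Q) (b : ℝ) {G : Matrix n n ℝ} (hG : G.PosSemidef) :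
    ∃ P : ℝ → Matrix n n ℝ, IsRiccatiSolOn A S Q (Set.Iic b) P ∧ P b = G ∧
      ∀ t ≤ b, (P t).PosSemidef := by
  obtain ⟨X, Y, hsol, -, -⟩ := exists_hamiltonian_family h.contA h.contS h.contQ b
  obtain ⟨hXY, hX, hY⟩ := hsol G
  have hY' : (Y G b).PosSemidef := by rwa [hY]
  refine ⟨fun t => Y G t * (X G t)⁻¹, fun t ht => (hXY.hasDerivAt_riccati
    (hXY.isUnit_left h.contA h.posS h.posQ ht hX hY')).hasDerivWithinAt, by simp [hX, hY],
    fun t ht => hXY.posSemidef_riccati h.contA h.posS h.posQ ht hX hY'⟩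

theorem riccatiRHS_eq {n m r : ℕ} (A : ℝ → Matrix (Fin n) (Fin n) ℝ)
    (B : ℝ → Matrix (Fin n) (Fin m) ℝ) (C : ℝ → Matrix (Fin r) (Fin n) ℝ)
    (R : ℝ → Matrix (Fin m) (Fin m) ℝ) (t : ℝ) (P : Matrix (Fin n) (Fin n) ℝ) :
    riccatiRHS A B C R t P =
      riccatiField A (fun t => B t * (R t)⁻¹ * (B t)ᵀ) (fun t => (C t)ᵀ * C t) t P := by
  simp only [riccatiRHS, riccatiField, Matrix.mul_assoc]

theorem isPeriodicRiccatiData {n m r : ℕ} {T : ℝ} (hT : 0 < T)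
    {A : ℝ → Matrix (Fin n) (Fin n) ℝ} {B : ℝ → Matrix (Fin n) (Fin m) ℝ}
    {C : ℝ → Matrix (Fin r) (Fin n) ℝ} {R : ℝ → Matrix (Fin m) (Fin m) ℝ}
    (hA : Continuous A) (hAT : Function.Periodic A T)
    (hB : Continuous B) (hBT : Function.Periodic B T)
    (hC : Continuous C) (hCT : Function.Periodic C T)
    (hR : Continuous R) (hRT : Function.Periodic R T) (hRpos : ∀ t, (R t).PosDef) :
    IsPeriodicRiccatiData T A (fun t => B t * (R t)⁻¹ * (B t)ᵀ) (fun t => (C t)ᵀ * C t) where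
  pos := hT
  contA := hA
  contS := by
    have hRi : Continuous fun t => (R t)⁻¹ := continuous_iff_continuousAt.2 fun t => by
      refine ContinuousAt.comp (g := fun M : Matrix (Fin m) (Fin m) ℝ => M⁻¹)
        (continuousAt_matrix_inv _ ?_) hR.continuousAt
      rw [Ring.inverse_eq_inv']
      exact continuousAt_inv₀ (hRpos t).det_pos.ne'
    exact (hB.matrix_mul hRi).matrix_mul hB.matrix_transpose
  contQ := hC.matrix_transpose.matrix_mul hC
  perA := hAT
  perS t := by simp only [hBT t, hRT t]
  perQ t := by simp only [hCT t]
  posS t := by simpa using (hRpos t).inv.posSemidef.transpose_mul_mul (B t)ᵀ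
  posQ t := by simpa [conjTranspose_eq_transpose_of_trivial] using
    posSemidef_conjTranspose_mul_self (C t)

/-- Completion of the square: the cost of the feedback `u = -Kx` exceeds the optimal one by the
weighted square of `K - R⁻¹BᵀP`. -/
theorem posSemidef_feedback_cost {n m : ℕ} {P : Matrix (Fin n) (Fin n) ℝ}
    {B : Matrix (Fin n) (Fin m) ℝ} {K : Matrix (Fin m) (Fin n) ℝ} {R : Matrix (Fin m) (Fin m) ℝ}
    (A Q : Matrix (Fin n) (Fin n) ℝ) (hR : R.PosDef) (hP : Pᵀ = P) :
    (P * (B * R⁻¹ * Bᵀ) * P - Q + (A - B * K - A)ᵀ * P + P * (A - B * K - A)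
      + (Kᵀ * R * K + Q)).PosSemidef := by
  have hu : IsUnit R.det := hR.det_pos.ne'.isUnit
  have hRt : (R⁻¹)ᵀ = R⁻¹ := hR.inv.posSemidef.transpose_eq
  convert hR.posSemidef.transpose_mul_mul (K - R⁻¹ * Bᵀ * P) using 1
  have h1 : R⁻¹ * R = 1 := nonsing_inv_mul _ hu
  have h2 : R * R⁻¹ = 1 := mul_nonsing_inv _ hu
  simp only [transpose_sub, transpose_mul, transpose_transpose, hRt, hP, Matrix.sub_mul,
    Matrix.mul_sub, Matrix.mul_assoc]
  rw [← Matrix.mul_assoc R⁻¹ R, h1, Matrix.one_mul, ← Matrix.mul_assoc R R⁻¹, h2, Matrix.one_mul]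
  abel

end Main

theorem theorem1 {n m r : ℕ} (T : ℝ) (hT : 0 < T)
    (A : ℝ → Matrix (Fin n) (Fin n) ℝ) (B : ℝ → Matrix (Fin n) (Fin m) ℝ)
    (C : ℝ → Matrix (Fin r) (Fin n) ℝ) (R : ℝ → Matrix (Fin m) (Fin m) ℝ)
    (hA : Continuous A) (hAT : Function.Periodic A T)
    (hB : Continuous B) (hBT : Function.Periodic B T)
    (hC : Continuous C) (hCT : Function.Periodic C T)
    (hR : Continuous R) (hRT : Function.Periodic R T) (hRpos : ∀ t, (R t).PosDef)
    (hstab : IsStabilizable T A B) (hdet : IsDetectable T A C) :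
    ∃ Pstar : ℝ → Matrix (Fin n) (Fin n) ℝ,
      IsStabilizingSolution T A B C R Pstar ∧
      (∀ Q, IsSPPSSolution T A B C R Q → Q = Pstar) ∧
      ∀ (t_f : ℝ) (G : Matrix (Fin n) (Fin n) ℝ), G.PosSemidef →
        ∃ P : ℝ → Matrix (Fin n) (Fin n) ℝ,
          IsFinalValueSolution A B C R t_f G P ∧
          (∀ Q, IsFinalValueSolution A B C R t_f G Q → Set.EqOn Q P (Set.Iic t_f)) ∧
          Filter.Tendsto (fun t => P t - Pstar t) Filter.atBot (nhds 0) := by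
  have h := isPeriodicRiccatiData hT hA hAT hB hBT hC hCT hR hRT hRpos
  obtain ⟨K, hK, -, Φ, ⟨hΦ1, hΦ⟩, hΦs⟩ := hstab
  obtain ⟨L, hL, -, Ψ, ⟨hΨ1, hΨ⟩, hΨs⟩ := hdet
  obtain ⟨Pstar, hd, hper, hpsd, hst, hlim⟩ := exists_attracting_periodic_solution h
    (W := fun t => (K t)ᵀ * R t * K t + (C t)ᵀ * C t)
    (((hK.matrix_transpose.matrix_mul hR).matrix_mul hK).add h.contQ)
    (Acl := fun t => A t - B t * K t) (fun t => hΦ t 0) (hΦ1 0)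
    (fun t P hP => posSemidef_feedback_cost (A t) _ (hRpos t) hP) hΦs
    (F := fun t => A t - L t * C t) (hA.sub (hL.matrix_mul hC)) (fun t => hΨ t 0) (hΨ1 0)
    (fun t v hv => by
      rw [← mulVec_mulVec, dotProduct_mulVec, vecMul_transpose, dotProduct_self_eq_zero] at hv
      rw [sub_mulVec, ← mulVec_mulVec, hv, mulVec_zero, sub_zero]) hΨs
  refine ⟨Pstar, ⟨⟨fun t => ?_, hper, hpsd⟩, hst⟩, fun Q hQ => ?_, fun t_f G hG => ?_⟩
  · rw [riccatiRHS_eq]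
    exact hd t
  · obtain ⟨hQd, hQT, hQs⟩ := hQ
    simp only [riccatiRHS_eq] at hQd
    have hQlim := hlim 0 Q (.of_hasDerivAt hQd) fun t _ => hQs t
    exact funext fun t => sub_eq_zero.1
      (eq_zero_of_periodic_of_tendsto hT (hQT.sub hper) hQlim t)
  · obtain ⟨P, hP, hPG, hPs⟩ := exists_final_value_solution h t_f hG
    refine ⟨P, ⟨fun t ht => ?_, hPG⟩, fun Q hQ => ?_, hlim t_f P hP hPs⟩
    · rw [riccatiRHS_eq]
      exact hP t ht
    · obtain ⟨hQd, hQG⟩ := hQ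
      simp only [riccatiRHS_eq] at hQd
      exact IsRiccatiSolOn.eqOn h.contA h.contS hQd hP (hQG.trans hPG.symm)
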